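/- Let $d\ge 2$ and let $$\phi(z)=\frac{a_0+a_1z+\cdots+a_{d-1}z^{d-1}+a_dz^d}{b_1z+\cdots+b_{d-1}z^{d-1}+b_dz^d}\in\mathbb{Q}_2(z),\qquad a_i,b_j\in\mathbb{Q}_2,\quad a_d=b_d=1,$$ be a rational map of degree $d$ (that is, numerator and denominator have no common factor); put $b_0:=0$. Let $\phi$ act on $\mathbb{P}^1(\mathbb{Q}_2)=\mathbb{Q}_2\cup\{\infty\}$, equipped with the spherical metric $\rho$, given by $\rho(z,w)=\frac{|z-w|_2}{\max\{|z|_2,1\}\max\{|w|_2,1\}}$ and $\rho(z,\infty)=\frac{1}{\max\{|z|_2,1\}}$ for $z,w\in\mathbb{Q}_2$, and $\rho(\infty,\infty)=0$. The map $\phi$ is called *minimal* on $\mathbb{P}^1(\mathbb{Q}_2)$ if every forward orbit is dense, and *$1$-Lipschitz* if $\rho(\phi(P),\phi(Q))\le\rho(P,Q)$ for all $P,Q$. It has *good reduction* if, writing $\phi=f/g$ with $f,g\in\mathbb{Z}_2[z]$ without common factors and with at least one coefficient of $f$ or $g$ of absolute value $1$, the reduction $\overline f/\overline g$ modulo $2$,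 after cancelling common factors, still has degree $d$. Set $$A_\phi=\sum_{0\le i\le d}a_i,\quad B_\phi=\sum_{1\le j\le d}b_j,\quad A_{\phi,1}=\sum_{\substack{0\le i\le d\\ i\equiv1\ (2)}}a_i,\quad A_{\phi,2}=\sum_{\substack{0\le i\le d\\ i\equiv1\ (4)}}a_i,\quad A_{\phi,3}=\sum_{\substack{0\le i\le d\\ i\equiv3\ (4)}}a_i,$$ and consider the system of conditions $$(\ast)\quad\begin{cases} a_i,b_j\in\mathbb{Z}_2\quad\text{for }0\le i\le d-1,\ 1\le j\le d-1,\\ a_0\equiv1\pmod 2,\\ B_\phi\equiv1\pmod 2,\\ A_\phi\equiv2\pmod 4,\\ A_{\phi,1}\equiv1\pmod 2,\\ b_1\equiv1\pmod 2,\\ a_{d-1}-b_{d-1}\equiv1\pmod 2,\\ a_0b_1(a_{d-1}-b_{d-1})(A_{\phi,2}-A_{\phi,3})B_\phi+2\,(b_2-a_1+a_{d-2}-b_{d-2}+b_{d-1}+A_{\phi,3})\equiv1\pmod 4. \end{cases}$$ If $\phi$ has good reduction and is minimal on $\mathbb{P}^1(\mathbb{Q}_2)$, then $(\ast)$ holds.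 Conversely, $(\ast)$ implies that $\phi$ is $1$-Lipschitz and minimal on $\mathbb{P}^1(\mathbb{Q}_2)$. -/

import Mathlib

open Polynomial OnePoint

noncomputable section

namespace PadicDyn

/-- The degree of a rational function: the maximum of the degrees of its numerator and
denominator, written without common factors. -/
def ratDegree {K : Type*} [Field K] (φ : RatFunc K) : ℕ :=
  max φ.num.natDegree φ.denom.natDegree

/-- The transformation of the projective line `ℙ¹(K) = K ∪ {∞}` induced by a rational function
`φ` (`φ.num` and `φ.denom` have no common factors).  At `∞` one compares the coefficients of
`z ^ n` in the numerator and the denominator, where `n` is the degree of `φ`. -/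
def ratMap {K : Type*} [Field K] (φ : RatFunc K) : OnePoint K → OnePoint K
  | ∞ =>
      open Classical in
      if φ.denom.coeff (ratDegree φ) = 0 then ∞
      else ((φ.num.coeff (ratDegree φ) / φ.denom.coeff (ratDegree φ) : K) : OnePoint K)
  | OnePoint.some z =>
      open Classical in
      if φ.denom.eval z = 0 then ∞
      else ((φ.num.eval z / φ.denom.eval z : K) : OnePoint K)

/-- The spherical metric on `ℙ¹(ℚ_p) = ℚ_p ∪ {∞}`. -/
def sphericalDist {p : ℕ} [Fact p.Prime] : OnePoint ℚ_[p] → OnePoint ℚ_[p] → ℝ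
  | ∞, ∞ => 0
  | ∞, OnePoint.some w => 1 / max ‖w‖ 1
  | OnePoint.some z, ∞ => 1 / max ‖z‖ 1
  | OnePoint.some z, OnePoint.some w => ‖z - w‖ / (max ‖z‖ 1 * max ‖w‖ 1)

/-- The transformation `T` of `ℙ¹(ℚ_p)` is `1`-Lipschitz for the spherical metric. -/
def IsOneLipschitz {p : ℕ} [Fact p.Prime] (T : OnePoint ℚ_[p] → OnePoint ℚ_[p]) : Prop :=
  ∀ P Q, sphericalDist (T P) (T Q) ≤ sphericalDist P Q

/-- The system `(ℙ¹(ℚ_p), T)` is minimal: every forward orbit is dense for the spherical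
metric. -/
def IsMinimalSystem {p : ℕ} [Fact p.Prime] (T : OnePoint ℚ_[p] → OnePoint ℚ_[p]) : Prop :=
  ∀ P Q, ∀ ε : ℝ, 0 < ε → ∃ k : ℕ, sphericalDist (T^[k] P) Q < ε

/-- The quotient of two polynomials, as a rational function. -/
def ratQuot {K : Type*} [Field K] (f g : K[X]) : RatFunc K :=
  algebraMap K[X] (RatFunc K) f / algebraMap K[X] (RatFunc K) g

/-- Good reduction: write `φ = f / g` with `f, g ∈ ℤ_p[z]` without common factors and with at
least one coefficient of `f` or `g` of absolute value `1`; then the reduction of `f / g` modulo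
`p`, a rational function over `ℤ / pℤ`, has the same degree as `φ`.  (Such a pair `f, g` is unique
up to a common unit of `ℤ_p`.  If the reduction of `g` is `0`, then the reduction of `φ` is the
constant `∞`, and `ratQuot` returns `0`: the degree is `0` in both readings.) -/
def HasGoodReduction {p : ℕ} [Fact p.Prime] (φ : RatFunc ℚ_[p]) : Prop :=
  ∃ f g : ℤ_[p][X],
    g ≠ 0 ∧
    IsCoprime (f.map PadicInt.Coe.ringHom) (g.map PadicInt.Coe.ringHom) ∧
    (∃ i, ‖f.coeff i‖ = 1 ∨ ‖g.coeff i‖ = 1) ∧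
    φ = ratQuot (f.map PadicInt.Coe.ringHom) (g.map PadicInt.Coe.ringHom) ∧
    ratDegree (ratQuot (f.map PadicInt.toZMod) (g.map PadicInt.toZMod)) = ratDegree φ

/-- `x ≡ y (mod m)` in `ℤ_p`: the difference lies in `m ℤ_p`. -/
def CongMod {p : ℕ} [Fact p.Prime] (m : ℕ) (x y : ℚ_[p]) : Prop :=
  ∃ t : ℤ_[p], x - y = (m : ℚ_[p]) * (t : ℚ_[p])

/-- The rational function
`(a₀ + a₁ z + ⋯ + a_d z ^ d) / (b₁ z + ⋯ + b_d z ^ d)`. -/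
def ratOfCoeffs {K : Type*} [Field K] (d : ℕ) (a b : ℕ → K) : RatFunc K :=
  ratQuot (∑ i ∈ Finset.range (d + 1), C (a i) * X ^ i)
    (∑ j ∈ Finset.Icc 1 d, C (b j) * X ^ j)

/-- The sum of the `a i`, `0 ≤ i ≤ d`. -/
def sumA (d : ℕ) (a : ℕ → ℚ_[2]) : ℚ_[2] := ∑ i ∈ Finset.range (d + 1), a i

/-- The sum of the `b j`, `1 ≤ j ≤ d`. -/
def sumB (d : ℕ) (b : ℕ → ℚ_[2]) : ℚ_[2] := ∑ j ∈ Finset.Icc 1 d, b j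

/-- The sum of the `a i` with `0 ≤ i ≤ d` and `i` odd. -/
def sumA1 (d : ℕ) (a : ℕ → ℚ_[2]) : ℚ_[2] := ∑ i ∈ Finset.range (d + 1) with i % 2 = 1, a i

/-- The sum of the `a i` with `0 ≤ i ≤ d` and `i ≡ 1 (mod 4)`. -/
def sumA2 (d : ℕ) (a : ℕ → ℚ_[2]) : ℚ_[2] := ∑ i ∈ Finset.range (d + 1) with i % 4 = 1, a i

/-- The sum of the `a i` with `0 ≤ i ≤ d` and `i ≡ 3 (mod 4)`. -/
def sumA3 (d : ℕ) (a : ℕ → ℚ_[2]) : ℚ_[2] := ∑ i ∈ Finset.range (d + 1) with i % 4 = 3, a i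

/-- The system of conditions on the coefficients. -/
def CoeffCondition (d : ℕ) (a b : ℕ → ℚ_[2]) : Prop :=
  ((∀ i, i ≤ d - 1 → ‖a i‖ ≤ 1) ∧ (∀ j, 1 ≤ j → j ≤ d - 1 → ‖b j‖ ≤ 1)) ∧
  CongMod 2 (a 0) 1 ∧
  CongMod 2 (sumB d b) 1 ∧
  CongMod 4 (sumA d a) 2 ∧
  CongMod 2 (sumA1 d a) 1 ∧
  CongMod 2 (b 1) 1 ∧
  CongMod 2 (a (d - 1) - b (d - 1)) 1 ∧
  CongMod 4
    (a 0 * b 1 * (a (d - 1) - b (d - 1)) * (sumA2 d a - sumA3 d a) * sumB d b +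
      2 * (b 2 - a 1 + a (d - 2) - b (d - 2) + b (d - 1) + sumA3 d a)) 1

end PadicDyn

end

/-!
Modulo `2` the map `φ` permutes the residue disks of `0`, `∞` and `1` cyclically,
`0 → ∞ → 1 → 0`. With `2 * x` as the local parameter `x` of a disk, each of the three maps between
disks is half the quotient of two polynomials evaluated at `2 * x`, so modulo `4` it is an affine
function of `x`, and so is the return map `R` of the disk of `0`. The return map is minimal on `ℤ₂`
if and only if `R 0` is odd and its multiplier `R 1 - R 0` is `1` modulo `4`: in that case the
iterate `R^[2 ^ k]` moves every point by exactly `2 ^ k`, up to a unit. The last congruence of the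
theorem evaluates the multiplier as the product of the multipliers of the three maps, which are read
off the coefficients of the numerator and the denominator next to `0`, `∞` and `1`.
-/

noncomputable section

namespace PadicDyn

section Parity

lemma two_dvd_or_exists_eq_one_add (x : ℤ_[2]) : 2 ∣ x ∨ ∃ e, x = 1 + 2 * e := by
  obtain ⟨n, hn, hx⟩ := PadicInt.exists_mem_range x
  rw [PadicInt.maximalIdeal_eq_span_p, Ideal.mem_span_singleton] at hx
  obtain ⟨e, he⟩ := hx
  push_cast at he
  interval_cases n
  · exact .inl ⟨e, by linear_combination he⟩
  · exact .inr ⟨e, by push_cast at he; linear_combination he⟩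

lemma two_dvd_iff_not_isUnit {x : ℤ_[2]} : 2 ∣ x ↔ ¬ IsUnit x := by
  rw [← mem_nonunits_iff, PadicInt.mem_nonunits, PadicInt.norm_lt_one_iff_dvd, Nat.cast_ofNat]

lemma isUnit_iff_of_two_dvd_sub {x y : ℤ_[2]} (h : 2 ∣ x - y) : IsUnit x ↔ IsUnit y := by
  rw [← not_iff_not, ← two_dvd_iff_not_isUnit, ← two_dvd_iff_not_isUnit]
  exact dvd_iff_dvd_of_dvd_sub h

lemma isUnit_one_add_two_mul (e : ℤ_[2]) : IsUnit (1 + 2 * e) :=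
  (isUnit_iff_of_two_dvd_sub ⟨e, by ring⟩).2 isUnit_one

lemma isUnit_iff_exists_eq_one_add {x : ℤ_[2]} : IsUnit x ↔ ∃ e, x = 1 + 2 * e := by
  refine ⟨fun h => ?_, ?_⟩
  · exact (two_dvd_or_exists_eq_one_add x).resolve_left fun h2 => two_dvd_iff_not_isUnit.1 h2 h
  · rintro ⟨e, rfl⟩
    exact isUnit_one_add_two_mul e

lemma isUnit_iff_two_dvd_sub_one {x : ℤ_[2]} : IsUnit x ↔ 2 ∣ x - 1 := by
  simp only [isUnit_iff_exists_eq_one_add, dvd_def, sub_eq_iff_eq_add']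

lemma four_dvd_iff {x : ℤ_[2]} : 4 ∣ x ↔ PadicInt.toZModPow 2 x = 0 := by
  rw [← RingHom.mem_ker, PadicInt.ker_toZModPow, Ideal.mem_span_singleton]
  norm_num

lemma two_mul_toZModPow {x : ℤ_[2]} (hx : IsUnit x) : 2 * PadicInt.toZModPow 2 x = 2 := by
  obtain ⟨e, rfl⟩ := isUnit_iff_exists_eq_one_add.1 hx
  rw [← map_ofNat (PadicInt.toZModPow (p := 2) 2), ← map_mul, ← sub_eq_zero, ← map_sub,
    ← four_dvd_iff]
  exact ⟨e, by ring⟩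

lemma four_dvd_pow_two_pow_sub_one {x : ℤ_[2]} (hx : IsUnit x) (k : ℕ) :
    4 ∣ x ^ 2 ^ (k + 1) - 1 := by
  obtain ⟨e, rfl⟩ := isUnit_iff_exists_eq_one_add.1 hx
  have h4 : 4 ∣ (1 + 2 * e) ^ 2 - 1 := ⟨e + e ^ 2, by ring⟩
  rw [pow_succ', pow_mul]
  simpa only [one_pow] using h4.trans (sub_dvd_pow_sub_pow _ 1 (2 ^ k))

end Parity

section NearlyAffine

lemma two_mul_eq_two_and_eq_one_of_forall_finset {c l : ZMod (2 ^ 2)}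
    (h : ∀ S : Finset (ZMod (2 ^ 2)), 0 ∈ S → (∀ x ∈ S, c + l * x ∈ S) → ∀ y, y ∈ S) :
    2 * c = 2 ∧ l = 1 := by
  revert c l
  decide

/-- The difference quotients `(F (x + h) - F x) / h` are congruent to `α` modulo the ideal
`(2 h, 4)`. The class is stable under composition and contains the half quotients of polynomials
below; over `ℤ_[2]` its members are affine modulo `4`. -/
def IsNearlyAffine {R : Type*} [CommRing R] (F : R → R) (α : R) : Prop :=
  ∀ x h, ∃ s t, F (x + h) = F x + h * (α + 2 * h * s + 4 * t)

namespace IsNearlyAffine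

section CommRing

variable {R : Type*} [CommRing R] {F G : R → R} {α γ : R}

lemma id : IsNearlyAffine (id : R → R) 1 := fun x h => ⟨0, 0, by simp⟩

lemma comp (hG : IsNearlyAffine G γ) (hF : IsNearlyAffine F α) :
    IsNearlyAffine (G ∘ F) (α * γ) := by
  intro x h
  obtain ⟨s, t, hst⟩ := hF x h
  set w := α + 2 * h * s + 4 * t with hw
  obtain ⟨s', t', hst'⟩ := hG (F x) (h * w)
  refine ⟨s * γ + w ^ 2 * s', t * γ + w * t', ?_⟩
  simp only [Function.comp]
  rw [hst, hst']
  linear_combination h * γ * hw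

lemma iterate (hF : IsNearlyAffine F α) (n : ℕ) : IsNearlyAffine F^[n] (α ^ n) := by
  induction n with
  | zero => simpa using IsNearlyAffine.id
  | succ n ih => rw [Function.iterate_succ, pow_succ']; exact ih.comp hF

end CommRing

variable {F : ℤ_[2] → ℤ_[2]} {α : ℤ_[2]}

lemma isUnit_iff (hF : IsNearlyAffine F α) : IsUnit α ↔ IsUnit (F 1 - F 0) := by
  obtain ⟨s, t, hst⟩ := hF 0 1
  rw [zero_add] at hst
  exact isUnit_iff_of_two_dvd_sub ⟨-(s + 2 * t), by linear_combination -hst⟩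

lemma norm_sub (hF : IsNearlyAffine F α) (hα : IsUnit α) (x y : ℤ_[2]) :
    ‖F x - F y‖ = ‖x - y‖ := by
  obtain ⟨s, t, hst⟩ := hF y (x - y)
  rw [add_sub_cancel] at hst
  have hunit : IsUnit (α + 2 * (x - y) * s + 4 * t) :=
    (isUnit_iff_of_two_dvd_sub ⟨(x - y) * s + 2 * t, by ring⟩).2 hα
  rw [hst, add_sub_cancel_left, norm_mul, PadicInt.isUnit_iff.1 hunit, mul_one]

lemma four_dvd_sub_affine (hF : IsNearlyAffine F α) (x : ℤ_[2]) :
    4 ∣ F x - (F 0 + (F 1 - F 0) * x) := by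
  obtain ⟨s, t, hst⟩ := hF 0 1
  rw [zero_add] at hst
  rcases two_dvd_or_exists_eq_one_add x with ⟨y, rfl⟩ | ⟨y, rfl⟩
  · obtain ⟨u, v, huv⟩ := hF 0 (2 * y)
    rw [zero_add] at huv
    exact ⟨2 * y * (y * u + v) - y * (s + 2 * t), by linear_combination huv - 2 * y * hst⟩
  · obtain ⟨u, v, huv⟩ := hF 1 (2 * y)
    exact ⟨2 * y * (y * u + v) - y * (s + 2 * t), by linear_combination huv - 2 * y * hst⟩

lemma four_dvd_sub_mul_sub (hF : IsNearlyAffine F α) (x y : ℤ_[2]) :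
    4 ∣ F x - F y - (F 1 - F 0) * (x - y) := by
  convert dvd_sub (hF.four_dvd_sub_affine x) (hF.four_dvd_sub_affine y) using 1
  ring

lemma exists_apply_apply_eq (hF : IsNearlyAffine F α) (hα : 4 ∣ α - 1) {x e : ℤ_[2]} {k : ℕ}
    (hx : F x = x + 2 ^ (k + 1) * (1 + 2 * e)) :
    ∃ e', F (F x) = x + 2 ^ (k + 2) * (1 + 2 * e') := by
  obtain ⟨u, hu⟩ := hα
  obtain ⟨s, t, hst⟩ := hF x (2 ^ (k + 1) * (1 + 2 * e))
  rw [← hx] at hst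
  exact ⟨e + (1 + 2 * e) * (u + t + 2 ^ k * (1 + 2 * e) * s), by
    linear_combination hst + hx + 2 ^ (k + 1) * (1 + 2 * e) * hu⟩

lemma iterate_two_pow (hF : IsNearlyAffine F α) (h0 : IsUnit (F 0)) (h1 : 4 ∣ F 1 - F 0 - 1)
    (k : ℕ) (x : ℤ_[2]) : ∃ e, F^[2 ^ k] x = x + 2 ^ k * (1 + 2 * e) := by
  obtain ⟨c, hc⟩ := isUnit_iff_exists_eq_one_add.1 h0
  obtain ⟨l, hl⟩ := h1
  have hα : IsUnit α := hF.isUnit_iff.2 <|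
    isUnit_iff_two_dvd_sub_one.2 ⟨2 * l, by linear_combination hl⟩
  have translation (x : ℤ_[2]) : ∃ e, F x = x + F 0 + 4 * e := by
    obtain ⟨e, he⟩ := hF.four_dvd_sub_affine x
    exact ⟨e + l * x, by linear_combination he + x * hl⟩
  obtain ⟨e, he⟩ := translation x
  rcases k with - | k
  · exact ⟨c + 2 * e, by rw [pow_zero, Function.iterate_one]; linear_combination he + hc⟩
  induction k with
  | zero =>
    obtain ⟨e', he'⟩ := translation (F x)
    exact ⟨c + e + e', by
      simp only [zero_add, pow_one, Function.iterate_succ_apply, Function.iterate_zero, id_eq]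
      linear_combination he' + he + 2 * hc⟩
  | succ k ih =>
    obtain ⟨e, he⟩ := ih
    rw [pow_succ, mul_two, Function.iterate_add_apply]
    exact (hF.iterate _).exists_apply_apply_eq (four_dvd_pow_two_pow_sub_one hα k) he

lemma exists_iterate_dvd (hF : IsNearlyAffine F α) (h0 : IsUnit (F 0))
    (h1 : 4 ∣ F 1 - F 0 - 1) (x y : ℤ_[2]) (k : ℕ) : ∃ n, 2 ^ k ∣ F^[n] x - y := by
  induction k with
  | zero => exact ⟨0, by simp⟩
  | succ k ih =>
    obtain ⟨n, t, ht⟩ := ih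
    rcases two_dvd_or_exists_eq_one_add t with ⟨s, rfl⟩ | ⟨s, rfl⟩
    · exact ⟨n, s, by linear_combination ht⟩
    · obtain ⟨e, he⟩ := hF.iterate_two_pow h0 h1 k (F^[n] x)
      refine ⟨2 ^ k + n, 1 + s + e, ?_⟩
      rw [Function.iterate_add_apply, he]
      linear_combination ht

lemma of_forall_exists_iterate_dvd (hF : IsNearlyAffine F α)
    (h : ∀ y, ∃ n, 4 ∣ F^[n] 0 - y) : IsUnit (F 0) ∧ 4 ∣ F 1 - F 0 - 1 := by
  let π : ℤ_[2] →+* ZMod (2 ^ 2) := PadicInt.toZModPow 2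
  have affine (x : ℤ_[2]) : π (F x) = π (F 0) + π (F 1 - F 0) * π x := by
    simpa only [map_sub, map_add, map_mul, sub_eq_zero] using
      four_dvd_iff.1 (hF.four_dvd_sub_affine x)
  have hπ : 2 * π (F 0) = 2 ∧ π (F 1 - F 0) = 1 := by
    refine two_mul_eq_two_and_eq_one_of_forall_finset fun S h0 hS y => ?_
    obtain ⟨y, rfl⟩ := ZMod.ringHom_surjective π y
    obtain ⟨n, hn⟩ := h y
    have orbit_mem (n : ℕ) : π (F^[n] 0) ∈ S := by
      induction n with
      | zero => simpa using h0
      | succ n ih => rw [Function.iterate_succ_apply', affine]; exact hS _ ih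
    rw [four_dvd_iff, map_sub, sub_eq_zero] at hn
    exact hn ▸ orbit_mem n
  refine ⟨?_, by rw [four_dvd_iff, map_sub, map_one]; exact sub_eq_zero.2 hπ.2⟩
  have h4 : 4 ∣ 2 * F 0 - 2 := by
    rw [four_dvd_iff, map_sub, map_mul, map_ofNat]; exact sub_eq_zero.2 hπ.1
  obtain ⟨c, hc⟩ := h4
  exact isUnit_iff_two_dvd_sub_one.2
    ⟨c, mul_left_cancel₀ (two_ne_zero (α := ℤ_[2])) (by linear_combination hc)⟩

end IsNearlyAffine

end NearlyAffine

section HalfQuot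

lemma exists_eval_two_mul_add {R : Type*} [CommRing R] (P : R[X]) (x h : R) :
    ∃ s t, P.eval (2 * (x + h)) = P.eval (2 * x) + 2 * h * (P.coeff 1 + 2 * h * s + 4 * t) := by
  obtain ⟨s, hs⟩ := P.binomExpansion (2 * x) (2 * h)
  obtain ⟨t, ht⟩ := (derivative P).binomExpansion 0 (2 * x)
  simp only [zero_add, ← coeff_zero_eq_eval_zero, coeff_derivative] at ht
  push_cast at ht
  exact ⟨s, P.coeff 2 * x + t * x ^ 2, by rw [mul_add]; linear_combination hs + 2 * h * ht⟩

lemma exists_eval_two_mul {R : Type*} [CommRing R] (P : R[X]) (x : R) :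
    ∃ t, P.eval (2 * x) = P.coeff 0 + 2 * x * P.coeff 1 + 4 * t := by
  obtain ⟨s, t, hst⟩ := exists_eval_two_mul_add P 0 x
  rw [zero_add, mul_zero, ← coeff_zero_eq_eval_zero] at hst
  exact ⟨x * (x * s + 2 * t), by linear_combination hst⟩

lemma isUnit_eval_two_mul {D : ℤ_[2][X]} (hD : IsUnit (D.coeff 0)) (x : ℤ_[2]) :
    IsUnit (D.eval (2 * x)) := by
  obtain ⟨t, ht⟩ := exists_eval_two_mul D x
  exact (isUnit_iff_of_two_dvd_sub ⟨x * D.coeff 1 + 2 * t, by linear_combination ht⟩).2 hD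

/-- `F x` is one half of the value at `2 x` of the fraction `N / D`: this is how `N / D` acts on
the disk `2 ℤ_[2]` in the coordinate `x`. -/
def IsHalfQuot (N D : ℤ_[2][X]) (F : ℤ_[2] → ℤ_[2]) : Prop :=
  ∀ x, 2 * F x * D.eval (2 * x) = N.eval (2 * x)

lemma exists_isHalfQuot {N D : ℤ_[2][X]} (hD : IsUnit (D.coeff 0)) (hN : 2 ∣ N.coeff 0) :
    ∃ F, IsHalfQuot N D F := by
  suffices h : ∀ x, ∃ y, 2 * y * D.eval (2 * x) = N.eval (2 * x) from Classical.skolem.1 h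
  intro x
  obtain ⟨c, hc⟩ := hN
  obtain ⟨t, ht⟩ := exists_eval_two_mul N x
  obtain ⟨u, hu⟩ := (isUnit_eval_two_mul hD x).exists_right_inv
  exact ⟨(c + x * N.coeff 1 + 2 * t) * u, by
    linear_combination 2 * (c + x * N.coeff 1 + 2 * t) * hu - ht - hc⟩

lemma exists_eq_of_mul_eq {R : Type*} [CommRing R] {m Δ h α s t u v : R} (hm : IsUnit m)
    (huv : m = 1 + 2 * h * u + 4 * v) (hΔ : Δ * m = h * (α + 2 * h * s + 4 * t)) :
    ∃ s' t', Δ = h * (α + 2 * h * s' + 4 * t') := by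
  obtain ⟨m', hm'⟩ := hm.exists_right_inv
  -- `w = Δ / h` satisfies `w * m = α + 2 * h * s + 4 * t`, and `m = 1` modulo `(2 * h, 4)`
  set w := (α + 2 * h * s + 4 * t) * m' with hw
  exact ⟨s - w * u, t - w * v, by
    linear_combination m' * hΔ - Δ * hm' - h * w * huv +
      h * (α + 2 * h * s + 4 * t) * hm' + h * (m - 1) * hw⟩

lemma IsHalfQuot.isNearlyAffine {N D : ℤ_[2][X]} {F : ℤ_[2] → ℤ_[2]} (hF : IsHalfQuot N D F)
    (hD : IsUnit (D.coeff 0)) :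
    IsNearlyAffine F (N.coeff 1 * D.coeff 0 - N.coeff 0 * D.coeff 1) := by
  intro x h
  obtain ⟨n, hn⟩ := exists_eval_two_mul N x
  obtain ⟨d, hd⟩ := exists_eval_two_mul D x
  obtain ⟨sN, tN, hN'⟩ := exists_eval_two_mul_add N x h
  obtain ⟨sD, tD, hD'⟩ := exists_eval_two_mul_add D x h
  obtain ⟨e, he⟩ := isUnit_iff_exists_eq_one_add.1 (isUnit_eval_two_mul hD x)
  have hunit := (isUnit_eval_two_mul hD x).mul (isUnit_eval_two_mul hD (x + h))
  have hx := hF x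
  have hxh := hF (x + h)
  generalize D.eval (2 * (x + h)) = D' at *
  generalize N.eval (2 * (x + h)) = N' at *
  generalize D.eval (2 * x) = D₀ at *
  generalize N.eval (2 * x) = N₀ at *
  obtain ⟨s, t, hst⟩ : ∃ s t, (F (x + h) - F x) * (D₀ * D') =
      h * (N.coeff 1 * D.coeff 0 - N.coeff 0 * D.coeff 1 + 2 * h * s + 4 * t) :=
    ⟨sN * D₀ - N₀ * sD, tN * D₀ - N₀ * tD + N.coeff 1 * d - n * D.coeff 1,
      mul_left_cancel₀ (two_ne_zero (α := ℤ_[2])) <| by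
        linear_combination D₀ * hxh - D' * hx + D₀ * hN' - N₀ * hD' + 2 * h * N.coeff 1 * hd -
          2 * h * D.coeff 1 * hn⟩
  obtain ⟨u, v, huv⟩ : ∃ u v, D₀ * D' = 1 + 2 * h * u + 4 * v :=
    ⟨D₀ * (D.coeff 1 + 2 * h * sD + 4 * tD), e + e ^ 2, by
      linear_combination D₀ * hD' + (D₀ + 1 + 2 * e) * he⟩
  obtain ⟨s', t', hst'⟩ := exists_eq_of_mul_eq hunit huv hst
  exact ⟨s', t', by linear_combination hst'⟩

end HalfQuot
section ProjectivePoints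

variable {p : ℕ} [Fact p.Prime] {x y x' y' : ℤ_[p]}

open Classical in
/-- The point `[x : y]` of the projective line over `ℚ_[p]`, for coordinates `x, y ∈ ℤ_[p]` that
are not both `0`. -/
def projPt (x y : ℤ_[p]) : OnePoint ℚ_[p] :=
  if y = 0 then ∞ else ((x / y : ℚ_[p]) : OnePoint ℚ_[p])

lemma projPt_zero (x : ℤ_[p]) : projPt x 0 = ∞ := if_pos rfl

lemma projPt_of_ne (x : ℤ_[p]) (hy : y ≠ 0) :
    projPt x y = ((x / y : ℚ_[p]) : OnePoint ℚ_[p]) := if_neg hy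

lemma projPt_one (x : ℤ_[p]) : projPt x 1 = ((x : ℚ_[p]) : OnePoint ℚ_[p]) := by
  rw [projPt_of_ne _ one_ne_zero, PadicInt.coe_one, div_one]

lemma projPt_mul_left {c : ℤ_[p]} (hc : c ≠ 0) (x y : ℤ_[p]) :
    projPt (c * x) (c * y) = projPt x y := by
  rcases eq_or_ne y 0 with rfl | hy
  · rw [mul_zero, projPt_zero, projPt_zero]
  · rw [projPt_of_ne _ hy, projPt_of_ne _ (mul_ne_zero hc hy), PadicInt.coe_mul, PadicInt.coe_mul,
      mul_div_mul_left _ _ (PadicInt.coe_ne_zero.2 hc)]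

lemma exists_eq_projPt (P : OnePoint ℚ_[p]) :
    (∃ x, P = projPt x 1) ∨ ∃ y, ¬ IsUnit y ∧ P = projPt 1 y := by
  induction P using OnePoint.rec with
  | infty => exact .inr ⟨0, not_isUnit_zero, (projPt_zero 1).symm⟩
  | coe z =>
    rcases le_or_gt ‖z‖ 1 with hz | hz
    · exact .inl ⟨⟨z, hz⟩, (projPt_one (⟨z, hz⟩ : ℤ_[p])).symm⟩
    · have hz0 : z ≠ 0 := norm_pos_iff.1 (one_pos.trans hz)
      have hinv : ‖z⁻¹‖ < 1 := by rw [norm_inv]; exact inv_lt_one_of_one_lt₀ hz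
      let y : ℤ_[p] := ⟨z⁻¹, hinv.le⟩
      have hy : y ≠ 0 := fun h => inv_ne_zero hz0 (congrArg Subtype.val h)
      refine .inr ⟨y, PadicInt.mem_nonunits.2 hinv, ?_⟩
      rw [projPt_of_ne _ hy, PadicInt.coe_one, one_div, inv_inv]

lemma max_norm_div_one (h : IsUnit x ∨ IsUnit y) (hy : y ≠ 0) :
    max ‖(x / y : ℚ_[p])‖ 1 = ‖y‖⁻¹ := by
  have hy' : 0 < ‖y‖ := norm_pos_iff.2 hy
  have hmax : max ‖x‖ ‖y‖ = 1 := by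
    rcases h with h | h
    · rw [PadicInt.isUnit_iff.1 h, max_eq_left (PadicInt.norm_le_one _)]
    · rw [PadicInt.isUnit_iff.1 h, max_eq_right (PadicInt.norm_le_one _)]
  rw [norm_div, PadicInt.padic_norm_e_of_padicInt, PadicInt.padic_norm_e_of_padicInt,
    ← div_self hy'.ne', max_div_div_right hy'.le, hmax, one_div]

lemma sphericalDist_projPt (h : IsUnit x ∨ IsUnit y) (h' : IsUnit x' ∨ IsUnit y') :
    sphericalDist (projPt x y) (projPt x' y') = ‖x * y' - x' * y‖ := by
  rcases eq_or_ne y 0 with rfl | hy <;> rcases eq_or_ne y' 0 with rfl | hy'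
  · simp [projPt_zero, sphericalDist]
  · have hx : IsUnit x := by simpa using h
    simp only [projPt_zero, projPt_of_ne _ hy', sphericalDist, max_norm_div_one h' hy', norm_mul,
      mul_zero, sub_zero, PadicInt.isUnit_iff.1 hx, one_mul, one_div, inv_inv]
  · have hx' : IsUnit x' := by simpa using h'
    simp only [projPt_zero, projPt_of_ne _ hy, sphericalDist, max_norm_div_one h hy, norm_neg,
      norm_mul, mul_zero, zero_sub, PadicInt.isUnit_iff.1 hx', one_mul, one_div, inv_inv]
  · have hyQ : (y : ℚ_[p]) ≠ 0 := PadicInt.coe_ne_zero.2 hy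
    have hyQ' : (y' : ℚ_[p]) ≠ 0 := PadicInt.coe_ne_zero.2 hy'
    rw [projPt_of_ne _ hy, projPt_of_ne _ hy']
    simp only [sphericalDist]
    rw [max_norm_div_one h hy, max_norm_div_one h' hy', div_sub_div _ _ hyQ hyQ', norm_div,
      norm_mul, ← mul_inv, div_inv_eq_mul, PadicInt.padic_norm_e_of_padicInt,
      PadicInt.padic_norm_e_of_padicInt, div_mul_cancel₀ _
        (mul_ne_zero (norm_ne_zero_iff.2 hy) (norm_ne_zero_iff.2 hy')), mul_comm (y : ℚ_[p]),
      ← PadicInt.padic_norm_e_of_padicInt, PadicInt.coe_sub, PadicInt.coe_mul, PadicInt.coe_mul]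

end ProjectivePoints

section ResidueDisks

/-- The residue disks of `0`, `∞` and `1` on the projective line over `ℚ_[2]`, in this order, each
parametrized by `ℤ_[2]`. -/
def chart : Fin 3 → ℤ_[2] → OnePoint ℚ_[2]
  | 0, x => projPt (2 * x) 1
  | 1, x => projPt 1 (2 * x)
  | 2, x => projPt (1 + 2 * x) 1

lemma exists_eq_chart (P : OnePoint ℚ_[2]) : ∃ i x, P = chart i x := by
  rcases exists_eq_projPt P with ⟨x, rfl⟩ | ⟨y, hy, rfl⟩
  · rcases two_dvd_or_exists_eq_one_add x with ⟨t, rfl⟩ | ⟨t, rfl⟩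
    · exact ⟨0, t, rfl⟩
    · exact ⟨2, t, rfl⟩
  · obtain ⟨t, rfl⟩ := two_dvd_iff_not_isUnit.2 hy
    exact ⟨1, t, rfl⟩

lemma sphericalDist_chart (i : Fin 3) (x y : ℤ_[2]) :
    sphericalDist (chart i x) (chart i y) = ‖2 * (x - y)‖ := by
  fin_cases i
  · exact (sphericalDist_projPt (by simp) (by simp)).trans (by ring_nf)
  · exact (sphericalDist_projPt (by simp) (by simp)).trans (by rw [← norm_neg]; ring_nf)
  · exact (sphericalDist_projPt (by simp) (by simp)).trans (by ring_nf)

lemma two_pow_dvd_sub_iff (i : Fin 3) (x y : ℤ_[2]) (k : ℕ) :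
    2 ^ k ∣ x - y ↔ sphericalDist (chart i x) (chart i y) ≤ 2⁻¹ ^ (k + 1) := by
  have h := PadicInt.norm_le_pow_iff_mem_span_pow (2 * (x - y)) (k + 1)
  rw [Ideal.mem_span_singleton, Nat.cast_ofNat, zpow_neg, zpow_natCast, ← inv_pow,
    Nat.cast_ofNat, pow_succ' (2 : ℤ_[2]), mul_dvd_mul_iff_left two_ne_zero] at h
  rw [sphericalDist_chart, h]

lemma sphericalDist_chart_of_ne {i j : Fin 3} (hij : i ≠ j) (x y : ℤ_[2]) :
    sphericalDist (chart i x) (chart j y) = 1 := by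
  have norm_odd (e z : ℤ_[2]) (hz : z = 1 + 2 * e) : ‖z‖ = 1 :=
    PadicInt.isUnit_iff.1 (isUnit_iff_exists_eq_one_add.2 ⟨e, hz⟩)
  fin_cases i <;> fin_cases j <;> first | exact absurd rfl hij | skip
  · exact (sphericalDist_projPt (by simp) (by simp)).trans (norm_odd (2 * x * y - 1) _ (by ring))
  · exact (sphericalDist_projPt (by simp) (by simp)).trans (norm_odd (x - y - 1) _ (by ring))
  · exact (sphericalDist_projPt (by simp) (by simp)).trans (norm_odd (-2 * x * y) _ (by ring))
  · exact (sphericalDist_projPt (by simp) (by simp)).trans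
      (norm_odd (-x * (1 + 2 * y)) _ (by ring))
  · exact (sphericalDist_projPt (by simp) (by simp)).trans (norm_odd (x - y) _ (by ring))
  · exact (sphericalDist_projPt (by simp) (by simp)).trans
      (norm_odd (y * (1 + 2 * x) - 1) _ (by ring))

/-- `T` permutes the three residue disks cyclically, `0 → ∞ → 1 → 0`, and acts on their
parameters by the maps `F i`. -/
def ActsCyclically (T : OnePoint ℚ_[2] → OnePoint ℚ_[2]) (F : Fin 3 → ℤ_[2] → ℤ_[2]) : Prop :=
  ∀ i x, T (chart i x) = chart (i + 1) (F i x)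

/-- The first return map to the residue disk of `0`. -/
def returnMap (F : Fin 3 → ℤ_[2] → ℤ_[2]) : ℤ_[2] → ℤ_[2] := F 2 ∘ F 1 ∘ F 0

namespace ActsCyclically

open scoped Fin.CommRing

variable {T : OnePoint ℚ_[2] → OnePoint ℚ_[2]} {F : Fin 3 → ℤ_[2] → ℤ_[2]}

lemma iterate_chart_zero (h : ActsCyclically T F) (n : ℕ) (x : ℤ_[2]) :
    T^[3 * n] (chart 0 x) = chart 0 ((returnMap F)^[n] x) := by
  have third_iterate : Function.Semiconj (chart 0) (returnMap F) T^[3] := fun x => by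
    simp only [Function.iterate_succ_apply, Function.iterate_zero, id_eq, h _ _]
    rfl
  rw [Function.iterate_mul]
  exact ((third_iterate.iterate_right n).eq x).symm

lemma exists_iterate_chart (h : ActsCyclically T F) (n : ℕ) (i : Fin 3) (x : ℤ_[2]) :
    ∃ y, T^[n] (chart i x) = chart (i + n) y := by
  induction n with
  | zero => exact ⟨x, by simp⟩
  | succ n ih =>
    obtain ⟨y, hy⟩ := ih
    exact ⟨F (i + n) y, by rw [Function.iterate_succ_apply', hy, h, Nat.cast_succ, add_assoc]⟩

lemma exists_iterate_eq_chart_zero (h : ActsCyclically T F) (P : OnePoint ℚ_[2]) :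
    ∃ n x, T^[n] P = chart 0 x := by
  obtain ⟨i, x, rfl⟩ := exists_eq_chart P
  obtain ⟨y, hy⟩ := h.exists_iterate_chart (-i : Fin 3) i x
  exact ⟨_, y, by rw [hy, Fin.cast_val_eq_self, add_neg_cancel]⟩

lemma sphericalDist_map (h : ActsCyclically T F) (hF : ∀ i x y, ‖F i x - F i y‖ = ‖x - y‖)
    (P Q : OnePoint ℚ_[2]) : sphericalDist (T P) (T Q) = sphericalDist P Q := by
  obtain ⟨i, x, rfl⟩ := exists_eq_chart P
  obtain ⟨j, y, rfl⟩ := exists_eq_chart Q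
  rw [h, h]
  rcases eq_or_ne i j with rfl | hij
  · rw [sphericalDist_chart, sphericalDist_chart, norm_mul, norm_mul, hF]
  · rw [sphericalDist_chart_of_ne hij, sphericalDist_chart_of_ne (add_left_injective 1 |>.ne hij)]

lemma sphericalDist_iterate (h : ActsCyclically T F) (hF : ∀ i x y, ‖F i x - F i y‖ = ‖x - y‖)
    (n : ℕ) (P Q : OnePoint ℚ_[2]) : sphericalDist (T^[n] P) (T^[n] Q) = sphericalDist P Q := by
  induction n with
  | zero => rfl
  | succ n ih => rw [Function.iterate_succ_apply', Function.iterate_succ_apply',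
      h.sphericalDist_map hF, ih]

lemma isMinimalSystem (h : ActsCyclically T F) (hF : ∀ i x y, ‖F i x - F i y‖ = ‖x - y‖)
    (hdense : ∀ x y k, ∃ n, 2 ^ k ∣ (returnMap F)^[n] x - y) : IsMinimalSystem T := by
  intro P Q ε hε
  obtain ⟨j, y, hy⟩ := h.exists_iterate_eq_chart_zero Q
  obtain ⟨s, x, hx⟩ := h.exists_iterate_eq_chart_zero (T^[j] P)
  obtain ⟨k, hk⟩ := exists_pow_lt_of_lt_one hε (show (2⁻¹ : ℝ) < 1 by norm_num)
  obtain ⟨n, hn⟩ := hdense x y k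
  refine ⟨3 * n + s, ?_⟩
  calc sphericalDist (T^[3 * n + s] P) Q
      = sphericalDist (T^[j] (T^[3 * n + s] P)) (T^[j] Q) := (h.sphericalDist_iterate hF ..).symm
    _ = sphericalDist (T^[3 * n] (T^[s] (T^[j] P))) (T^[j] Q) := by
      simp only [← Function.iterate_add_apply]; congr 2; ring
    _ = sphericalDist (chart 0 ((returnMap F)^[n] x)) (chart 0 y) := by
      rw [hx, hy, h.iterate_chart_zero]
    _ ≤ 2⁻¹ ^ (k + 1) := (two_pow_dvd_sub_iff ..).1 hn
    _ ≤ 2⁻¹ ^ k := pow_le_pow_of_le_one (by norm_num) (by norm_num) k.le_succ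
    _ < ε := hk

lemma exists_iterate_dvd (h : ActsCyclically T F) (hT : IsMinimalSystem T) (x y : ℤ_[2]) (k : ℕ) :
    ∃ n, 2 ^ k ∣ (returnMap F)^[n] x - y := by
  obtain ⟨m, hm⟩ := hT (chart 0 x) (chart 0 y) (2⁻¹ ^ (k + 1)) (by positivity)
  obtain ⟨n, rfl⟩ : 3 ∣ m := by
    rw [← Fin.natCast_eq_zero]
    by_contra hm0
    obtain ⟨z, hz⟩ := h.exists_iterate_chart m 0 x
    rw [hz, zero_add, sphericalDist_chart_of_ne hm0] at hm
    exact hm.not_ge (pow_le_one₀ (by norm_num) (by norm_num))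
  rw [h.iterate_chart_zero] at hm
  exact ⟨n, (two_pow_dvd_sub_iff ..).2 hm.le⟩

end ActsCyclically

end ResidueDisks
section RationalFunctions

variable {K : Type*} [Field K] {p q : K[X]}

lemma exists_eq_num_mul_and_eq_denom_mul (p : K[X]) (hq : q ≠ 0) :
    ∃ k, p = (ratQuot p q).num * k ∧ q = (ratQuot p q).denom * k := by
  obtain ⟨k, hk⟩ := RatFunc.denom_div_dvd p q
  change q = (ratQuot p q).denom * k at hk
  have hcross : (ratQuot p q).num * q = p * (ratQuot p q).denom :=
    (RatFunc.num_mul_eq_mul_denom_iff hq).2 rfl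
  refine ⟨k, mul_right_cancel₀ (ratQuot p q).denom_ne_zero ?_, hk⟩
  linear_combination (ratQuot p q).num * hk - hcross

lemma exists_C_of_isCoprime (h : IsCoprime p q) (hq : q ≠ 0) :
    ∃ c, p = (ratQuot p q).num * C c ∧ q = (ratQuot p q).denom * C c := by
  obtain ⟨k, hp, hk⟩ := exists_eq_num_mul_and_eq_denom_mul p hq
  obtain ⟨c, -, rfl⟩ := Polynomial.isUnit_iff.1 <|
    h.isUnit_of_dvd' (Dvd.intro_left _ hp.symm) (Dvd.intro_left _ hk.symm)
  exact ⟨c, hp, hk⟩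

lemma num_denom_ratQuot (hq : q.Monic) (h : IsCoprime p q) :
    (ratQuot p q).num = p ∧ (ratQuot p q).denom = q := by
  obtain ⟨c, hp, hqc⟩ := exists_C_of_isCoprime h hq.ne_zero
  have hc : c = 1 := by
    have hlead := congrArg leadingCoeff hqc
    rwa [hq.leadingCoeff, leadingCoeff_mul, RatFunc.monic_denom, one_mul, leadingCoeff_C,
      eq_comm] at hlead
  rw [hc, C_1, mul_one] at hp hqc
  exact ⟨hp.symm, hqc.symm⟩

lemma ratDegree_ratQuot_zero (p : K[X]) : ratDegree (ratQuot p 0) = 0 := by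
  simp [ratDegree, ratQuot]

lemma ratDegree_ratQuot_le (p q : K[X]) :
    ratDegree (ratQuot p q) ≤ max p.natDegree q.natDegree := by
  rcases eq_or_ne q 0 with rfl | hq
  · simp [ratDegree_ratQuot_zero]
  rcases eq_or_ne p 0 with rfl | hp
  · simp [ratQuot, ratDegree]
  exact max_le_max (natDegree_le_of_dvd (RatFunc.num_div_dvd p hq) hp)
    (natDegree_le_of_dvd (RatFunc.denom_div_dvd p q) hq)

lemma isCoprime_of_ratDegree_ratQuot {d : ℕ} (hd : 0 < d) (hp : p.natDegree ≤ d)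
    (hq : q.natDegree ≤ d) (h : ratDegree (ratQuot p q) = d) : IsCoprime p q := by
  have hq0 : q ≠ 0 := by
    rintro rfl
    exact hd.ne' (h ▸ ratDegree_ratQuot_zero p)
  obtain ⟨k, hpk, hqk⟩ := exists_eq_num_mul_and_eq_denom_mul p hq0
  have hk0 : k ≠ 0 := right_ne_zero_of_mul (hqk ▸ hq0)
  have hk : k.natDegree = 0 := by
    have hdenom : (ratQuot p q).denom.natDegree + k.natDegree ≤ d := by
      rwa [← natDegree_mul (RatFunc.denom_ne_zero _) hk0, ← hqk]
    have hnum : (ratQuot p q).num = 0 ∨ (ratQuot p q).num.natDegree + k.natDegree ≤ d :=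
      or_iff_not_imp_left.2 fun hn => by rwa [← natDegree_mul hn hk0, ← hpk]
    rw [ratDegree] at h
    rcases hnum with hn | hnum
    · rw [hn, natDegree_zero] at h
      omega
    · omega
  have hku : IsUnit k := isUnit_iff_degree_eq_zero.2 (by rw [degree_eq_natDegree hk0, hk]; rfl)
  have hcop := (isCoprime_mul_unit_right hku _ _).2 (ratQuot p q).isCoprime_num_denom
  rwa [← hpk, ← hqk] at hcop

end RationalFunctions

section IntegralModels

variable {p : ℕ} [Fact p.Prime] {φ : RatFunc ℚ_[p]} {f g : ℤ_[p][X]}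

/-- `φ = f / g` in lowest terms, with `f` and `g` integral and `g` monic. -/
structure IsIntegralModel (φ : RatFunc ℚ_[p]) (f g : ℤ_[p][X]) : Prop where
  num_eq : φ.num = f.map PadicInt.Coe.ringHom
  denom_eq : φ.denom = g.map PadicInt.Coe.ringHom

lemma coe_ringHom_injective : Function.Injective (PadicInt.Coe.ringHom : ℤ_[p] →+* ℚ_[p]) :=
  Subtype.coe_injective

lemma coe_eval (f : ℤ_[p][X]) (z : ℤ_[p]) :
    (f.map PadicInt.Coe.ringHom).eval (z : ℚ_[p]) = f.eval z :=
  eval_map_apply PadicInt.Coe.ringHom z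

lemma eval_map_inv {d : ℕ} (hf : f.natDegree ≤ d) {w : ℤ_[p]} (hw : w ≠ 0) :
    (f.map PadicInt.Coe.ringHom).eval (w : ℚ_[p])⁻¹ =
      (reflect d f).eval w * (w : ℚ_[p])⁻¹ ^ d := by
  let _ : Invertible (w : ℚ_[p])⁻¹ := invertibleOfNonzero (inv_ne_zero (PadicInt.coe_ne_zero.2 hw))
  rw [eval_map, ← eval₂_reflect_mul_pow PadicInt.Coe.ringHom (w : ℚ_[p])⁻¹ d f hf, invOf_eq_inv,
    inv_inv, ← eval_map, coe_eval]

lemma ratMap_coe_eq_projPt {z c : ℚ_[p]} {x y : ℤ_[p]} (hc : c ≠ 0)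
    (hx : φ.num.eval z = x * c) (hy : φ.denom.eval z = y * c) :
    ratMap φ (z : OnePoint ℚ_[p]) = projPt x y := by
  rcases eq_or_ne y 0 with rfl | hy0
  · rw [projPt_zero]
    exact if_pos (by rw [hy, PadicInt.coe_zero, zero_mul])
  · rw [projPt_of_ne _ hy0, ← mul_div_mul_right _ _ hc, ← hx, ← hy]
    exact if_neg (by rw [hy]; exact mul_ne_zero (PadicInt.coe_ne_zero.2 hy0) hc)

namespace IsIntegralModel

lemma natDegree_num_le (h : IsIntegralModel φ f g) : f.natDegree ≤ ratDegree φ := by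
  rw [← natDegree_map_eq_of_injective coe_ringHom_injective f, ← h.num_eq]
  exact le_max_left ..

lemma natDegree_denom_le (h : IsIntegralModel φ f g) : g.natDegree ≤ ratDegree φ := by
  rw [← natDegree_map_eq_of_injective coe_ringHom_injective g, ← h.denom_eq]
  exact le_max_right ..

lemma ratMap_projPt_one (h : IsIntegralModel φ f g) (z : ℤ_[p]) :
    ratMap φ (projPt z 1) = projPt (f.eval z) (g.eval z) := by
  rw [projPt_one]
  exact ratMap_coe_eq_projPt one_ne_zero (by rw [h.num_eq, coe_eval, mul_one])
    (by rw [h.denom_eq, coe_eval, mul_one])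

lemma ratMap_projPt_one_left (h : IsIntegralModel φ f g) (w : ℤ_[p]) :
    ratMap φ (projPt 1 w) =
      projPt ((reflect (ratDegree φ) f).eval w) ((reflect (ratDegree φ) g).eval w) := by
  rcases eq_or_ne w 0 with rfl | hw
  · have hf : φ.num.coeff (ratDegree φ) = f.coeff (ratDegree φ) := by rw [h.num_eq, coeff_map]; rfl
    have hg : φ.denom.coeff (ratDegree φ) = g.coeff (ratDegree φ) := by
      rw [h.denom_eq, coeff_map]; rfl
    rw [projPt_zero, ← coeff_zero_eq_eval_zero, ← coeff_zero_eq_eval_zero, coeff_reflect,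
      coeff_reflect, revAt_zero]
    rcases eq_or_ne (g.coeff (ratDegree φ)) 0 with hg0 | hg0
    · rw [hg0, projPt_zero]
      exact if_pos (by rw [hg, hg0, PadicInt.coe_zero])
    · rw [projPt_of_ne _ hg0, ← hf, ← hg]
      exact if_neg (by rw [hg]; exact PadicInt.coe_ne_zero.2 hg0)
  · rw [projPt_of_ne _ hw, PadicInt.coe_one, one_div]
    exact ratMap_coe_eq_projPt (pow_ne_zero _ (inv_ne_zero (PadicInt.coe_ne_zero.2 hw)))
      (by rw [h.num_eq, eval_map_inv h.natDegree_num_le hw])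
      (by rw [h.denom_eq, eval_map_inv h.natDegree_denom_le hw])

end IsIntegralModel

lemma toZMod_eq_zero_iff_not_isUnit {x : ℤ_[p]} : PadicInt.toZMod x = 0 ↔ ¬ IsUnit x := by
  rw [← RingHom.mem_ker, PadicInt.ker_toZMod, IsLocalRing.mem_maximalIdeal, mem_nonunits_iff]

lemma isUnit_coeff_or_of_ratDegree_reduction {d : ℕ} (hd : 0 < d) (hf : f.natDegree ≤ d)
    (hg : g.natDegree ≤ d)
    (h : ratDegree (ratQuot (f.map PadicInt.toZMod) (g.map PadicInt.toZMod)) = d) :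
    IsUnit (f.coeff d) ∨ IsUnit (g.coeff d) := by
  by_contra! hcoeff
  have natDegree_lt {P : ℤ_[p][X]} (hP : P.natDegree ≤ d) (hPd : ¬ IsUnit (P.coeff d)) :
      (P.map PadicInt.toZMod).natDegree < d := by
    refine (natDegree_map_le.trans hP).lt_of_ne fun heq => hd.ne' ?_
    have hlead : (P.map PadicInt.toZMod).leadingCoeff = 0 := by
      rw [leadingCoeff, heq, coeff_map, toZMod_eq_zero_iff_not_isUnit.2 hPd]
    rw [← heq, leadingCoeff_eq_zero.1 hlead, natDegree_zero]
  exact (ratDegree_ratQuot_le _ _).not_gt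
    (h ▸ max_lt (natDegree_lt hf hcoeff.1) (natDegree_lt hg hcoeff.2))

lemma isUnit_eval_or_of_isCoprime_reduction
    (h : IsCoprime (f.map PadicInt.toZMod) (g.map PadicInt.toZMod)) (z : ℤ_[p]) :
    IsUnit (f.eval z) ∨ IsUnit (g.eval z) := by
  obtain ⟨u, v, huv⟩ := h
  by_contra! hz
  have hroot := congrArg (eval (PadicInt.toZMod z)) huv
  rw [eval_add, eval_mul, eval_mul, eval_map_apply, eval_map_apply,
    toZMod_eq_zero_iff_not_isUnit.2 hz.1, toZMod_eq_zero_iff_not_isUnit.2 hz.2] at hroot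
  simp at hroot

lemma HasGoodReduction.exists_isIntegralModel (h : HasGoodReduction φ) (hd : 0 < ratDegree φ)
    (hnum : φ.num.coeff (ratDegree φ) = 1) (hdenom : φ.denom.coeff (ratDegree φ) = 1) :
    ∃ f g, IsIntegralModel φ f g ∧ ∀ z, IsUnit (f.eval z) ∨ IsUnit (g.eval z) := by
  obtain ⟨F, G, hG, hcop, -, hφ, hred⟩ := h
  obtain ⟨c, hFc, hGc⟩ := exists_C_of_isCoprime hcop
    ((Polynomial.map_ne_zero_iff coe_ringHom_injective).2 hG)
  rw [← hφ] at hFc hGc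
  have hFd : F.natDegree ≤ ratDegree φ := by
    rw [← natDegree_map_eq_of_injective coe_ringHom_injective, hFc]
    exact (natDegree_mul_C_le _ _).trans (le_max_left ..)
  have hGd : G.natDegree ≤ ratDegree φ := by
    rw [← natDegree_map_eq_of_injective coe_ringHom_injective, hGc]
    exact (natDegree_mul_C_le _ _).trans (le_max_right ..)
  obtain ⟨u, hu⟩ : ∃ u : ℤ_[p]ˣ, PadicInt.Coe.ringHom u.val = c := by
    have hF : PadicInt.Coe.ringHom (F.coeff (ratDegree φ)) = c := by
      simpa [hnum] using congrArg (coeff · (ratDegree φ)) hFc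
    have hG : PadicInt.Coe.ringHom (G.coeff (ratDegree φ)) = c := by
      simpa [hdenom] using congrArg (coeff · (ratDegree φ)) hGc
    rcases isUnit_coeff_or_of_ratDegree_reduction hd hFd hGd hred with ⟨u, hu⟩ | ⟨u, hu⟩
    · exact ⟨u, hu ▸ hF⟩
    · exact ⟨u, hu ▸ hG⟩
  have cancel {P : ℤ_[p][X]} {P' : ℚ_[p][X]} (hP : P.map PadicInt.Coe.ringHom = P' * C c) :
      P' = (C (u⁻¹ : ℤ_[p]ˣ).val * P).map PadicInt.Coe.ringHom := by
    have hinv : PadicInt.Coe.ringHom (u⁻¹ : ℤ_[p]ˣ).val * c = 1 := by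
      rw [← hu, ← map_mul, Units.inv_mul, map_one]
    rw [Polynomial.map_mul, map_C, hP, mul_left_comm, ← C_mul, hinv, C_1, mul_one]
  refine ⟨C (u⁻¹ : ℤ_[p]ˣ).val * F, C (u⁻¹ : ℤ_[p]ˣ).val * G, ⟨cancel hFc, cancel hGc⟩, fun z => ?_⟩
  simpa using isUnit_eval_or_of_isCoprime_reduction
    (isCoprime_of_ratDegree_ratQuot hd (natDegree_map_le.trans hFd) (natDegree_map_le.trans hGd)
      hred) z

end IntegralModels

section TransitionMaps

/-- A pair of integral polynomials of degree `d`, normalized as the numerator and the denominator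
of the theorem, whose quotient permutes the residue disks cyclically, `0 → ∞ → 1 → 0`. -/
structure IsCyclicPair (d : ℕ) (f g : ℤ_[2][X]) : Prop where
  natDegree_num_le : f.natDegree ≤ d
  num_coeff : f.coeff d = 1
  denom_coeff : g.coeff d = 1
  denom_coeff_zero : g.coeff 0 = 0
  isUnit_num_coeff_zero : IsUnit (f.coeff 0)
  two_dvd_num_eval_one : 2 ∣ f.eval 1
  isUnit_denom_eval_one : IsUnit (g.eval 1)

/-- The maps `F i` by which `f / g`, of degree `d`, acts on the parameters of the residue disks of
`0`, `∞` and `1`. The map `F 1` lands in the disk of `1`, whence the subtraction of `1` from the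
quotient `reflect d f / reflect d g`. -/
structure IsTransition (d : ℕ) (f g : ℤ_[2][X]) (F : Fin 3 → ℤ_[2] → ℤ_[2]) : Prop where
  zero : IsHalfQuot g f (F 0)
  infty : IsHalfQuot (reflect d f - reflect d g) (reflect d g) (F 1)
  one : IsHalfQuot (taylor 1 f) (taylor 1 g) (F 2)

lemma coeff_zero_reflect {R : Type*} [Semiring R] (d : ℕ) (P : R[X]) :
    (reflect d P).coeff 0 = P.coeff d := by
  rw [coeff_reflect, revAt_zero]

variable {φ : RatFunc ℚ_[2]} {d : ℕ} {f g : ℤ_[2][X]} {F : Fin 3 → ℤ_[2] → ℤ_[2]}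

namespace IsCyclicPair

lemma isUnit_coeff_zero_reflect (h : IsCyclicPair d f g) : IsUnit ((reflect d g).coeff 0) := by
  rw [coeff_zero_reflect, h.denom_coeff]
  exact isUnit_one

lemma isUnit_coeff_zero_taylor (h : IsCyclicPair d f g) : IsUnit ((taylor 1 g).coeff 0) := by
  rw [taylor_coeff_zero]
  exact h.isUnit_denom_eval_one

lemma exists_isTransition (h : IsCyclicPair d f g) : ∃ F, IsTransition d f g F := by
  obtain ⟨F₀, h₀⟩ := exists_isHalfQuot (N := g) h.isUnit_num_coeff_zero
    (by rw [h.denom_coeff_zero]; exact dvd_zero _)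
  obtain ⟨F₁, h₁⟩ := exists_isHalfQuot (N := reflect d f - reflect d g) h.isUnit_coeff_zero_reflect
    (by simp only [coeff_sub, coeff_zero_reflect, h.num_coeff, h.denom_coeff, sub_self, dvd_zero])
  obtain ⟨F₂, h₂⟩ := exists_isHalfQuot (N := taylor 1 f) h.isUnit_coeff_zero_taylor
    (by rw [taylor_coeff_zero]; exact h.two_dvd_num_eval_one)
  exact ⟨![F₀, F₁, F₂], h₀, h₁, h₂⟩

end IsCyclicPair

namespace IsTransition

lemma actsCyclically (hF : IsTransition (ratDegree φ) f g F) (h : IsCyclicPair (ratDegree φ) f g)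
    (hφ : IsIntegralModel φ f g) : ActsCyclically (ratMap φ) F := by
  intro i x
  fin_cases i
  · change ratMap φ (projPt (2 * x) 1) = projPt 1 (2 * F 0 x)
    rw [hφ.ratMap_projPt_one, ← hF.zero x, mul_comm _ (eval _ f),
      ← projPt_mul_left (isUnit_eval_two_mul h.isUnit_num_coeff_zero x).ne_zero 1, mul_one]
  · have hquot := hF.infty x
    rw [eval_sub] at hquot
    change ratMap φ (projPt 1 (2 * x)) = projPt (1 + 2 * F 1 x) 1
    rw [hφ.ratMap_projPt_one_left,
      ← projPt_mul_left (isUnit_eval_two_mul h.isUnit_coeff_zero_reflect x).ne_zero (1 + _),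
      mul_one]
    congr 1
    linear_combination -hquot
  · have hquot := hF.one x
    have hne := (isUnit_eval_two_mul h.isUnit_coeff_zero_taylor x).ne_zero
    rw [taylor_eval, add_comm] at hne
    rw [taylor_eval, taylor_eval, add_comm] at hquot
    change ratMap φ (projPt (1 + 2 * x) 1) = projPt (2 * F 2 x) 1
    rw [hφ.ratMap_projPt_one, ← projPt_mul_left hne (2 * _), mul_one, ← hquot, mul_comm]

lemma exists_isNearlyAffine (hF : IsTransition d f g F) (h : IsCyclicPair d f g) :
    ∃ α : Fin 3 → ℤ_[2], ∀ i, IsNearlyAffine (F i) (α i) := by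
  refine Classical.skolem.1 fun i => ?_
  fin_cases i
  · exact ⟨_, hF.zero.isNearlyAffine h.isUnit_num_coeff_zero⟩
  · exact ⟨_, hF.infty.isNearlyAffine h.isUnit_coeff_zero_reflect⟩
  · exact ⟨_, hF.one.isNearlyAffine h.isUnit_coeff_zero_taylor⟩

end IsTransition

lemma two_dvd_eval_one_of_isMinimalSystem (hφ : IsIntegralModel φ f g)
    (hf : f.coeff (ratDegree φ) = 1) (hmin : IsMinimalSystem (ratMap φ)) : 2 ∣ f.eval 1 := by
  rw [two_dvd_iff_not_isUnit]
  intro hf1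
  -- the residue disks of `∞` and `1` are then mapped into their union
  have mem_invariant (n : ℕ) : ∃ x y, IsUnit x ∧ (ratMap φ)^[n] (projPt 1 0) = projPt x y := by
    induction n with
    | zero => exact ⟨1, 0, isUnit_one, rfl⟩
    | succ n ih =>
      obtain ⟨_, y, ⟨u, rfl⟩, hn⟩ := ih
      have hu : projPt (u : ℤ_[2]) y = projPt 1 ((u⁻¹).val * y) := by
        rw [← projPt_mul_left u.ne_zero 1, mul_one, Units.mul_inv_cancel_left]
      rw [Function.iterate_succ_apply', hn, hu]
      rcases two_dvd_or_exists_eq_one_add ((u⁻¹).val * y) with ⟨t, ht⟩ | ht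
      · rw [ht, hφ.ratMap_projPt_one_left]
        exact ⟨_, _, isUnit_eval_two_mul (by rw [coeff_zero_reflect, hf]; exact isUnit_one) t, rfl⟩
      · obtain ⟨v, hv⟩ := isUnit_iff_exists_eq_one_add.2 ht
        obtain ⟨t, ht⟩ := isUnit_iff_two_dvd_sub_one.1 (v⁻¹).isUnit
        rw [← hv, ← projPt_mul_left (v⁻¹).ne_zero 1, Units.inv_mul, mul_one, hφ.ratMap_projPt_one]
        exact ⟨_, _, (isUnit_iff_of_two_dvd_sub ((Dvd.intro _ ht.symm).trans
          (sub_dvd_eval_sub _ _ f))).2 hf1, rfl⟩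
  obtain ⟨n, hn⟩ := hmin (projPt 1 0) (projPt 0 1) 1 one_pos
  obtain ⟨x, y, hx, hxy⟩ := mem_invariant n
  rw [hxy, sphericalDist_projPt (.inl hx) (.inr isUnit_one), mul_one, zero_mul, sub_zero,
    PadicInt.isUnit_iff.1 hx] at hn
  exact lt_irrefl _ hn

end TransitionMaps

section Multipliers

lemma IsNearlyAffine.returnMap {F : Fin 3 → ℤ_[2] → ℤ_[2]} {α : Fin 3 → ℤ_[2]}
    (hF : ∀ i, IsNearlyAffine (F i) (α i)) :
    IsNearlyAffine (returnMap F) (α 0 * α 1 * α 2) :=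
  (hF 2).comp ((hF 1).comp (hF 0))

lemma four_dvd_returnMap_sub {F : Fin 3 → ℤ_[2] → ℤ_[2]} {α : Fin 3 → ℤ_[2]}
    (hF : ∀ i, IsNearlyAffine (F i) (α i)) :
    4 ∣ returnMap F 1 - returnMap F 0 -
      (F 0 1 - F 0 0) * (F 1 1 - F 1 0) * (F 2 1 - F 2 0) := by
  obtain ⟨s, hs⟩ := (hF 1).four_dvd_sub_mul_sub (F 0 1) (F 0 0)
  obtain ⟨t, ht⟩ := (hF 2).four_dvd_sub_mul_sub (F 1 (F 0 1)) (F 1 (F 0 0))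
  exact ⟨t + (F 2 1 - F 2 0) * s, by
    simp only [PadicDyn.returnMap, Function.comp_apply]
    linear_combination ht + (F 2 1 - F 2 0) * hs⟩

lemma exists_eval_two {R : Type*} [CommRing R] (P : R[X]) :
    ∃ t, P.eval 2 = P.coeff 0 + 2 * P.coeff 1 + 4 * P.coeff 2 + 8 * t := by
  have expand (Q : R[X]) : Q.eval 2 = Q.coeff 0 + 2 * Q.divX.eval 2 := by
    conv_lhs => rw [← divX_mul_X_add Q]
    rw [eval_add, eval_mul, eval_X, eval_C]
    ring
  refine ⟨P.divX.divX.divX.eval 2, ?_⟩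
  rw [expand P, expand P.divX, expand P.divX.divX, coeff_divX, coeff_divX, coeff_divX]
  ring

lemma IsHalfQuot.four_dvd_sub {N D : ℤ_[2][X]} {F : ℤ_[2] → ℤ_[2]} (hF : IsHalfQuot N D F) :
    4 ∣ (F 1 - F 0) * D.coeff 0 + 2 * F 1 * D.coeff 1 - (N.coeff 1 + 2 * N.coeff 2) := by
  obtain ⟨n, hn⟩ := exists_eval_two N
  obtain ⟨e, he⟩ := exists_eval_two D
  have h0 := hF 0
  have h1 := hF 1
  rw [mul_zero, ← coeff_zero_eq_eval_zero, ← coeff_zero_eq_eval_zero] at h0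
  rw [mul_one, hn, he] at h1
  exact ⟨n - F 1 * (D.coeff 2 + 2 * e), mul_left_cancel₀ (two_ne_zero (α := ℤ_[2])) (by
    linear_combination h1 - h0)⟩

/-- The sum of the coefficients of `P` in the degrees `i ≤ d` with `i ≡ r` modulo `m`. -/
def coeffSum {R : Type*} [Semiring R] (d m r : ℕ) (P : R[X]) : R :=
  ∑ i ∈ Finset.range (d + 1) with i % m = r, P.coeff i

lemma coeffSum_two_one {R : Type*} [Semiring R] (d : ℕ) (P : R[X]) :
    coeffSum d 2 1 P = coeffSum d 4 1 P + coeffSum d 4 3 P := by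
  rw [coeffSum, coeffSum, coeffSum, ← Finset.sum_union]
  · congr 1
    ext i
    simp only [Finset.mem_filter, Finset.mem_union]
    grind
  · exact Finset.disjoint_filter.2 fun i _ h1 h3 => by omega

lemma eight_dvd_eval_three_sub {R : Type*} [CommRing R] {d : ℕ} {P : R[X]}
    (hP : P.natDegree ≤ d) : 8 ∣ P.eval 3 - P.eval 1 - 2 * coeffSum d 2 1 P := by
  rw [eval_eq_sum_range' (Nat.lt_succ_of_le hP), eval_eq_sum_range' (Nat.lt_succ_of_le hP),
    coeffSum, Finset.sum_filter, Finset.mul_sum, ← Finset.sum_sub_distrib,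
    ← Finset.sum_sub_distrib]
  refine Finset.dvd_sum fun i _ => ?_
  obtain ⟨t, ht⟩ : (8 : R) ∣ 9 ^ (i / 2) - 1 := by
    convert sub_one_dvd_pow_sub_one (9 : R) (i / 2) using 1
    norm_num
  rcases Nat.mod_two_eq_zero_or_one i with hi | hi
  · have hpow : (3 : R) ^ i = 9 ^ (i / 2) := by
      conv_lhs => rw [← Nat.div_add_mod i 2, hi, add_zero, pow_mul]
      norm_num
    simp only [hi, hpow, one_pow, zero_ne_one, if_false]
    exact ⟨P.coeff i * t, by linear_combination P.coeff i * ht⟩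
  · have hpow : (3 : R) ^ i = 3 * 9 ^ (i / 2) := by
      conv_lhs => rw [← Nat.div_add_mod i 2, hi, pow_succ', pow_mul]
      norm_num
    simp only [hi, hpow, one_pow, if_true]
    exact ⟨3 * P.coeff i * t, by linear_combination 3 * P.coeff i * ht⟩

lemma zmod_four_sq_eq_one {x : ZMod (2 ^ 2)} (hx : 2 * x = 2) : x ^ 2 = 1 := by
  revert x
  decide

lemma mul_mul_eq_of_multipliers {a₀ a₁ b₁ b₂ r q s B S T l₀ l₁ l₂ : ZMod (2 ^ 2)}
    (ha₀ : 2 * a₀ = 2) (hr : 2 * r = 2) (hB : 2 * B = 2)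
    (hl₀ : 2 * l₀ = 2) (hl₁ : 2 * l₁ = 2) (hl₂ : 2 * l₂ = 2)
    (h₀ : l₀ * a₀ + 2 * l₀ * a₁ = b₁ + 2 * b₂) (h₁ : l₁ + 2 * l₁ * s = r + 2 * q)
    (h₂ : l₂ * B = S + T) :
    l₀ * l₁ * l₂ = a₀ * b₁ * r * (S - T) * B + 2 * (b₂ - a₁ + q + s + T) := by
  have h4 : (4 : ZMod (2 ^ 2)) = 0 := rfl
  have e₀ : l₀ = a₀ * b₁ + 2 * (b₂ - a₁) := by
    linear_combination a₀ * h₀ - l₀ * zmod_four_sq_eq_one ha₀ - a₁ * a₀ * hl₀ + (b₂ - a₁) * ha₀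
  have e₁ : l₁ = r + 2 * (q + s) := by linear_combination h₁ - s * hl₁ - s * h4
  have e₂ : l₂ = B * (S + T) := by linear_combination B * h₂ - l₂ * zmod_four_sq_eq_one hB
  have hab : 2 * (a₀ * b₁) = 2 := by linear_combination hl₀ - 2 * e₀ - (b₂ - a₁) * h4
  linear_combination l₁ * l₂ * e₀ + a₀ * b₁ * l₂ * e₁ + a₀ * b₁ * r * e₂ +
    (b₂ - a₁) * (l₂ * hl₁ + hl₂) + (q + s) * (l₂ * hab + hl₂) + T * (r * B * hab + B * hr + hB)

end Multipliers

section ReturnCondition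

/-- The conditions of the theorem that are not part of `IsCyclicPair`, for the numerator `f` and
the denominator `g` of an integral model of degree `d`. -/
structure ReturnCondition (d : ℕ) (f g : ℤ_[2][X]) : Prop where
  four_dvd_num_eval_one : 4 ∣ f.eval 1 - 2
  isUnit_coeffSum : IsUnit (coeffSum d 2 1 f)
  isUnit_denom_coeff_one : IsUnit (g.coeff 1)
  isUnit_sub : IsUnit (f.coeff (d - 1) - g.coeff (d - 1))
  four_dvd_multiplier_sub : 4 ∣ f.coeff 0 * g.coeff 1 * (f.coeff (d - 1) - g.coeff (d - 1)) *
      (coeffSum d 4 1 f - coeffSum d 4 3 f) * g.eval 1 +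
    2 * (g.coeff 2 - f.coeff 1 + f.coeff (d - 2) - g.coeff (d - 2) + g.coeff (d - 1) +
      coeffSum d 4 3 f) - 1

variable {d : ℕ} {f g : ℤ_[2][X]} {F : Fin 3 → ℤ_[2] → ℤ_[2]}

lemma coeff_reflect_sub {R : Type*} [Semiring R] {d k : ℕ} (hk : k ≤ d) (P : R[X]) :
    (reflect d P).coeff k = P.coeff (d - k) := by
  rw [coeff_reflect, revAt_le hk]

namespace IsTransition

lemma apply_zero_zero (hF : IsTransition d f g F) (h : IsCyclicPair d f g) : F 0 0 = 0 := by
  have hzero := hF.zero 0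
  rw [mul_zero, ← coeff_zero_eq_eval_zero, ← coeff_zero_eq_eval_zero, h.denom_coeff_zero] at hzero
  simpa [h.isUnit_num_coeff_zero.ne_zero] using hzero

lemma apply_one_zero (hF : IsTransition d f g F) (h : IsCyclicPair d f g) : F 1 0 = 0 := by
  have hinfty := hF.infty 0
  rw [mul_zero, ← coeff_zero_eq_eval_zero, ← coeff_zero_eq_eval_zero, coeff_sub,
    coeff_zero_reflect, coeff_zero_reflect, h.num_coeff, h.denom_coeff] at hinfty
  simpa using hinfty

lemma returnMap_zero (hF : IsTransition d f g F) (h : IsCyclicPair d f g) :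
    returnMap F 0 = F 2 0 := by
  rw [returnMap, Function.comp_apply, Function.comp_apply, hF.apply_zero_zero h,
    hF.apply_one_zero h]

lemma isUnit_returnMap_zero_iff (hF : IsTransition d f g F) (h : IsCyclicPair d f g) :
    IsUnit (returnMap F 0) ↔ 4 ∣ f.eval 1 - 2 := by
  have hone := hF.one 0
  rw [mul_zero, taylor_eval, taylor_eval, zero_add] at hone
  have hfour : f.eval 1 - 2 = 2 * (F 2 0 * g.eval 1 - 1) := by linear_combination -hone
  rw [hfour, show (4 : ℤ_[2]) = 2 * 2 by norm_num, mul_dvd_mul_iff_left two_ne_zero,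
    ← isUnit_iff_two_dvd_sub_one, IsUnit.mul_iff, and_iff_left h.isUnit_denom_eval_one,
    hF.returnMap_zero h]

lemma four_dvd_multiplier_zero (hF : IsTransition d f g F) (h : IsCyclicPair d f g) :
    4 ∣ F 0 1 * f.coeff 0 + 2 * F 0 1 * f.coeff 1 - (g.coeff 1 + 2 * g.coeff 2) := by
  simpa only [hF.apply_zero_zero h, sub_zero] using hF.zero.four_dvd_sub

lemma four_dvd_multiplier_infty (hF : IsTransition d f g F) (h : IsCyclicPair d f g)
    (hd : 2 ≤ d) :
    4 ∣ F 1 1 + 2 * F 1 1 * g.coeff (d - 1) - (f.coeff (d - 1) - g.coeff (d - 1) +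
      2 * (f.coeff (d - 2) - g.coeff (d - 2))) := by
  simpa only [hF.apply_one_zero h, sub_zero, coeff_sub, coeff_zero_reflect, h.denom_coeff,
    mul_one, coeff_reflect_sub hd, coeff_reflect_sub (one_le_two.trans hd)]
    using hF.infty.four_dvd_sub

lemma exists_four_dvd_multiplier_one (hF : IsTransition d f g F) (h : IsCyclicPair d f g) :
    ∃ m, 4 ∣ (F 2 1 - F 2 0) * g.eval 1 + 2 * F 2 1 * m - coeffSum d 2 1 f := by
  have h0 := hF.one 0
  have h1 := hF.one 1
  rw [mul_zero, taylor_eval, taylor_eval, zero_add] at h0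
  rw [mul_one, taylor_eval, taylor_eval, show (2 + 1 : ℤ_[2]) = 3 by norm_num] at h1
  obtain ⟨t, ht⟩ := eight_dvd_eval_three_sub h.natDegree_num_le
  obtain ⟨m, hm⟩ := sub_dvd_eval_sub 3 1 g
  exact ⟨m, t, mul_left_cancel₀ (two_ne_zero (α := ℤ_[2])) (by
    linear_combination h1 - h0 + ht - 2 * F 2 1 * hm)⟩

lemma isUnit_multiplier_zero_iff (hF : IsTransition d f g F) (h : IsCyclicPair d f g) :
    IsUnit (F 0 1) ↔ IsUnit (g.coeff 1) := by
  obtain ⟨t, ht⟩ := hF.four_dvd_multiplier_zero h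
  rw [← isUnit_iff_of_two_dvd_sub (x := F 0 1 * f.coeff 0) (y := g.coeff 1)
    ⟨2 * t + g.coeff 2 - F 0 1 * f.coeff 1, by linear_combination ht⟩, IsUnit.mul_iff,
    and_iff_left h.isUnit_num_coeff_zero]

lemma isUnit_multiplier_infty_iff (hF : IsTransition d f g F) (h : IsCyclicPair d f g)
    (hd : 2 ≤ d) : IsUnit (F 1 1) ↔ IsUnit (f.coeff (d - 1) - g.coeff (d - 1)) := by
  obtain ⟨t, ht⟩ := hF.four_dvd_multiplier_infty h hd
  exact isUnit_iff_of_two_dvd_sub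
    ⟨2 * t + (f.coeff (d - 2) - g.coeff (d - 2)) - F 1 1 * g.coeff (d - 1), by
      linear_combination ht⟩

lemma isUnit_multiplier_one_iff (hF : IsTransition d f g F) (h : IsCyclicPair d f g) :
    IsUnit (F 2 1 - F 2 0) ↔ IsUnit (coeffSum d 2 1 f) := by
  obtain ⟨m, t, ht⟩ := hF.exists_four_dvd_multiplier_one h
  rw [← isUnit_iff_of_two_dvd_sub (x := (F 2 1 - F 2 0) * g.eval 1) (y := coeffSum d 2 1 f)
    ⟨2 * t - F 2 1 * m, by linear_combination ht⟩, IsUnit.mul_iff,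
    and_iff_left h.isUnit_denom_eval_one]

lemma four_dvd_multiplier_mul_sub (hF : IsTransition d f g F) (h : IsCyclicPair d f g)
    (hd : 2 ≤ d) (hzero : IsUnit (F 2 0)) (h₀ : IsUnit (F 0 1)) (h₁ : IsUnit (F 1 1))
    (h₂ : IsUnit (F 2 1 - F 2 0)) :
    4 ∣ F 0 1 * F 1 1 * (F 2 1 - F 2 0) -
      (f.coeff 0 * g.coeff 1 * (f.coeff (d - 1) - g.coeff (d - 1)) *
          (coeffSum d 4 1 f - coeffSum d 4 3 f) * g.eval 1 +
        2 * (g.coeff 2 - f.coeff 1 + f.coeff (d - 2) - g.coeff (d - 2) + g.coeff (d - 1) +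
          coeffSum d 4 3 f)) := by
  have hr := (hF.isUnit_multiplier_infty_iff h hd).1 h₁
  obtain ⟨s, hs⟩ : 2 ∣ F 2 1 := by
    rw [two_dvd_iff_not_isUnit]
    intro hone
    rw [isUnit_iff_two_dvd_sub_one] at hone hzero
    exact two_dvd_iff_not_isUnit.1 (by simpa using dvd_sub hone hzero) h₂
  have hc₀ := hF.four_dvd_multiplier_zero h
  have hc₁ := hF.four_dvd_multiplier_infty h hd
  obtain ⟨m, hc₂⟩ := hF.exists_four_dvd_multiplier_one h
  rw [show 2 * F 2 1 * m = 4 * (s * m) by linear_combination 2 * m * hs, coeffSum_two_one] at hc₂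
  rw [four_dvd_iff, map_sub, sub_eq_zero] at hc₀ hc₁ hc₂ ⊢
  simp only [map_add, map_sub, map_mul, map_ofNat] at hc₀ hc₁ hc₂ ⊢
  rw [show (4 : ZMod (2 ^ 2)) = 0 from rfl, zero_mul, add_zero] at hc₂
  rw [mul_mul_eq_of_multipliers (two_mul_toZModPow h.isUnit_num_coeff_zero)
    (by simpa only [map_sub] using two_mul_toZModPow hr)
    (two_mul_toZModPow h.isUnit_denom_eval_one) (two_mul_toZModPow h₀) (two_mul_toZModPow h₁)
    (by simpa only [map_sub] using two_mul_toZModPow h₂) hc₀ hc₁ hc₂]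
  ring

lemma four_dvd_returnMap_sub (hF : IsTransition d f g F) (h : IsCyclicPair d f g) :
    4 ∣ returnMap F 1 - returnMap F 0 - F 0 1 * F 1 1 * (F 2 1 - F 2 0) := by
  obtain ⟨α, hα⟩ := hF.exists_isNearlyAffine h
  simpa only [hF.apply_zero_zero h, hF.apply_one_zero h, sub_zero] using
    PadicDyn.four_dvd_returnMap_sub hα

lemma returnMap_iff (hF : IsTransition d f g F) (h : IsCyclicPair d f g) (hd : 2 ≤ d) :
    IsUnit (returnMap F 0) ∧ 4 ∣ returnMap F 1 - returnMap F 0 - 1 ↔ ReturnCondition d f g := by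
  have hmul := hF.four_dvd_returnMap_sub h
  have hzero := hF.returnMap_zero h
  constructor
  · rintro ⟨h0, h1⟩
    have hprod : IsUnit (F 0 1 * F 1 1 * (F 2 1 - F 2 0)) := by
      rw [isUnit_iff_two_dvd_sub_one]
      obtain ⟨t, ht⟩ := dvd_sub h1 hmul
      exact ⟨2 * t, by linear_combination ht⟩
    rw [IsUnit.mul_iff, IsUnit.mul_iff] at hprod
    obtain ⟨⟨h₀, h₁⟩, h₂⟩ := hprod
    refine ⟨(hF.isUnit_returnMap_zero_iff h).1 h0, (hF.isUnit_multiplier_one_iff h).1 h₂,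
      (hF.isUnit_multiplier_zero_iff h).1 h₀, (hF.isUnit_multiplier_infty_iff h hd).1 h₁, ?_⟩
    obtain ⟨t, ht⟩ := dvd_sub (dvd_sub h1 hmul)
      (hF.four_dvd_multiplier_mul_sub h hd (hzero ▸ h0) h₀ h₁ h₂)
    exact ⟨t, by linear_combination ht⟩
  · rintro ⟨hnum, hsum, hcoeff, hsub, hmultiplier⟩
    have h0 := (hF.isUnit_returnMap_zero_iff h).2 hnum
    obtain ⟨t, ht⟩ := dvd_add (dvd_add hmul hmultiplier)
      (hF.four_dvd_multiplier_mul_sub h hd (hzero ▸ h0) ((hF.isUnit_multiplier_zero_iff h).2 hcoeff)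
        ((hF.isUnit_multiplier_infty_iff h hd).2 hsub) ((hF.isUnit_multiplier_one_iff h).2 hsum))
    exact ⟨h0, t, by linear_combination ht⟩

lemma norm_sub (hF : IsTransition d f g F) (h : IsCyclicPair d f g) (hd : 2 ≤ d)
    (hret : ReturnCondition d f g) (i : Fin 3) (x y : ℤ_[2]) : ‖F i x - F i y‖ = ‖x - y‖ := by
  obtain ⟨α, hα⟩ := hF.exists_isNearlyAffine h
  refine (hα i).norm_sub ((hα i).isUnit_iff.2 ?_) x y
  fin_cases i
  · change IsUnit (F 0 1 - F 0 0)
    rw [hF.apply_zero_zero h, sub_zero]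
    exact (hF.isUnit_multiplier_zero_iff h).2 hret.isUnit_denom_coeff_one
  · change IsUnit (F 1 1 - F 1 0)
    rw [hF.apply_one_zero h, sub_zero]
    exact (hF.isUnit_multiplier_infty_iff h hd).2 hret.isUnit_sub
  · exact (hF.isUnit_multiplier_one_iff h).2 hret.isUnit_coeffSum

end IsTransition

variable {φ : RatFunc ℚ_[2]}

theorem IsCyclicPair.isMinimalSystem_iff (h : IsCyclicPair (ratDegree φ) f g)
    (hφ : IsIntegralModel φ f g) (hd : 2 ≤ ratDegree φ) :
    IsMinimalSystem (ratMap φ) ↔ ReturnCondition (ratDegree φ) f g := by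
  obtain ⟨F, hF⟩ := h.exists_isTransition
  obtain ⟨α, hα⟩ := hF.exists_isNearlyAffine h
  have hcyc := hF.actsCyclically h hφ
  have hreturn := IsNearlyAffine.returnMap hα
  rw [← hF.returnMap_iff h hd]
  refine ⟨fun hmin => hreturn.of_forall_exists_iterate_dvd fun y => ?_, fun ⟨h0, h1⟩ => ?_⟩
  · obtain ⟨n, hn⟩ := hcyc.exists_iterate_dvd hmin 0 y 2
    exact ⟨n, by norm_num at hn; exact hn⟩
  · exact hcyc.isMinimalSystem (hF.norm_sub h hd ((hF.returnMap_iff h hd).1 ⟨h0, h1⟩))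
      (hreturn.exists_iterate_dvd h0 h1)

theorem IsCyclicPair.isOneLipschitz (h : IsCyclicPair (ratDegree φ) f g)
    (hφ : IsIntegralModel φ f g) (hd : 2 ≤ ratDegree φ) (hret : ReturnCondition (ratDegree φ) f g) :
    IsOneLipschitz (ratMap φ) := by
  obtain ⟨F, hF⟩ := h.exists_isTransition
  exact fun P Q =>
    ((hF.actsCyclically h hφ).sphericalDist_map (hF.norm_sub h hd hret) P Q).le

end ReturnCondition

section Coefficients

/-- The rational function `φ`, of degree `d`, is `(a₀ + ⋯ + a_d z ^ d) / (b₁ z + ⋯ + b_d z ^ d)`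
in lowest terms, with the normalization `a_d = b_d = 1` of the theorem and `b₀ = 0`. -/
structure HasCoeffs {K : Type*} [Field K] (φ : RatFunc K) (a b : ℕ → K) : Prop where
  num_coeff : ∀ i ≤ ratDegree φ, φ.num.coeff i = a i
  denom_coeff : ∀ i ≤ ratDegree φ, φ.denom.coeff i = b i
  num_lead : a (ratDegree φ) = 1
  denom_lead : b (ratDegree φ) = 1
  denom_zero : b 0 = 0

lemma sum_Icc_one_eq_sum_range {M : Type*} [AddCommMonoid M] (d : ℕ) {c : ℕ → M} (h : c 0 = 0) :
    ∑ j ∈ Finset.Icc 1 d, c j = ∑ j ∈ Finset.range (d + 1), c j := by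
  rw [Finset.sum_range_eq_add_Ico _ d.succ_pos, h, zero_add]
  rfl

lemma coeff_sum_C_mul_X_pow {R : Type*} [Semiring R] {d i : ℕ} (c : ℕ → R) (hi : i ≤ d) :
    (∑ i ∈ Finset.range (d + 1), C (c i) * X ^ i).coeff i = c i := by
  simp only [finsetSum_coeff, coeff_C_mul_X_pow, Finset.sum_ite_eq, Finset.mem_range,
    Nat.lt_succ_of_le hi, if_true]

lemma natDegree_sum_C_mul_X_pow_le {R : Type*} [Semiring R] (d : ℕ) (c : ℕ → R) :
    (∑ i ∈ Finset.range (d + 1), C (c i) * X ^ i).natDegree ≤ d :=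
  natDegree_sum_le_of_forall_le _ _ fun _ hi =>
    (natDegree_C_mul_X_pow_le _ _).trans (Nat.lt_succ_iff.1 (Finset.mem_range.1 hi))

lemma hasCoeffs_ratOfCoeffs {K : Type*} [Field K] {d : ℕ} {a b : ℕ → K} {φ : RatFunc K}
    (hφ : φ = ratOfCoeffs d a b) (hd : 0 < d) (hdeg : ratDegree φ = d) (ha : a d = 1)
    (hb : b d = 1) (hb0 : b 0 = 0) : HasCoeffs φ a b := by
  rw [ratOfCoeffs, sum_Icc_one_eq_sum_range d (by rw [hb0, C_0, zero_mul])] at hφ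
  have hq := natDegree_sum_C_mul_X_pow_le d b
  have hcoprime := isCoprime_of_ratDegree_ratQuot hd (natDegree_sum_C_mul_X_pow_le d a) hq
    (hφ ▸ hdeg)
  obtain ⟨hnum, hdenom⟩ := num_denom_ratQuot (monic_of_natDegree_le_of_coeff_eq_one d hq
    ((coeff_sum_C_mul_X_pow b le_rfl).trans hb)) hcoprime
  rw [← hφ] at hnum hdenom
  subst hdeg
  exact ⟨fun i hi => by rw [hnum, coeff_sum_C_mul_X_pow a hi],
    fun i hi => by rw [hdenom, coeff_sum_C_mul_X_pow b hi], ha, hb, hb0⟩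

lemma congMod_coe_iff {p : ℕ} [Fact p.Prime] (m : ℕ) (x y : ℤ_[p]) :
    CongMod m (x : ℚ_[p]) (y : ℚ_[p]) ↔ (m : ℤ_[p]) ∣ x - y := by
  refine exists_congr fun t => ?_
  rw [← PadicInt.coe_natCast, ← PadicInt.coe_sub, ← PadicInt.coe_mul]
  exact Subtype.coe_injective.eq_iff

lemma congMod_two_one_iff (x : ℤ_[2]) : CongMod 2 (x : ℚ_[2]) 1 ↔ IsUnit x := by
  rw [isUnit_iff_two_dvd_sub_one]
  exact_mod_cast congMod_coe_iff 2 x 1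

variable {φ : RatFunc ℚ_[2]} {d : ℕ} {a b : ℕ → ℚ_[2]} {f g : ℤ_[2][X]}

lemma sum_filter_mod_eq_coeffSum (ha : ∀ i ≤ d, a i = f.coeff i) (m r : ℕ) :
    ∑ i ∈ Finset.range (d + 1) with i % m = r, a i = (coeffSum d m r f : ℤ_[2]) := by
  rw [coeffSum, PadicInt.coe_sum]
  exact Finset.sum_congr rfl fun i hi =>
    ha i (Nat.lt_succ_iff.1 (Finset.mem_range.1 (Finset.mem_filter.1 hi).1))

lemma sumA_eq_eval_one (ha : ∀ i ≤ d, a i = f.coeff i) (hf : f.natDegree ≤ d) :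
    sumA d a = (f.eval 1 : ℤ_[2]) := by
  rw [eval_eq_sum_range' (Nat.lt_succ_of_le hf), PadicInt.coe_sum]
  exact Finset.sum_congr rfl fun i hi => by
    rw [one_pow, mul_one, ha i (Nat.lt_succ_iff.1 (Finset.mem_range.1 hi))]

namespace IsIntegralModel

lemma coeff_num_eq (h : IsIntegralModel φ f g) (hφ : HasCoeffs φ a b) :
    ∀ i ≤ ratDegree φ, a i = f.coeff i := fun i hi => by
  rw [← hφ.num_coeff i hi, h.num_eq, coeff_map]
  rfl

lemma coeff_denom_eq (h : IsIntegralModel φ f g) (hφ : HasCoeffs φ a b) :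
    ∀ i ≤ ratDegree φ, b i = g.coeff i := fun i hi => by
  rw [← hφ.denom_coeff i hi, h.denom_eq, coeff_map]
  rfl

lemma coeff_eq_one (h : IsIntegralModel φ f g) (hφ : HasCoeffs φ a b) :
    f.coeff (ratDegree φ) = 1 ∧ g.coeff (ratDegree φ) = 1 :=
  ⟨coe_ringHom_injective ((h.coeff_num_eq hφ _ le_rfl).symm.trans hφ.num_lead),
    coe_ringHom_injective ((h.coeff_denom_eq hφ _ le_rfl).symm.trans hφ.denom_lead)⟩

lemma denom_coeff_zero (h : IsIntegralModel φ f g) (hφ : HasCoeffs φ a b) : g.coeff 0 = 0 :=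
  coe_ringHom_injective ((h.coeff_denom_eq hφ _ (Nat.zero_le _)).symm.trans hφ.denom_zero)

lemma isCyclicPair_iff (h : IsIntegralModel φ f g) (hφ : HasCoeffs φ a b) :
    IsCyclicPair (ratDegree φ) f g ↔
      IsUnit (f.coeff 0) ∧ 2 ∣ f.eval 1 ∧ IsUnit (g.eval 1) :=
  ⟨fun hc => ⟨hc.isUnit_num_coeff_zero, hc.two_dvd_num_eval_one, hc.isUnit_denom_eval_one⟩,
    fun ⟨h0, hf1, hg1⟩ => ⟨h.natDegree_num_le, (h.coeff_eq_one hφ).1, (h.coeff_eq_one hφ).2,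
      h.denom_coeff_zero hφ, h0, hf1, hg1⟩⟩

lemma coeffCondition_iff (h : IsIntegralModel φ f g) (hφ : HasCoeffs φ a b)
    (hd : 2 ≤ ratDegree φ) :
    CoeffCondition (ratDegree φ) a b ↔
      IsCyclicPair (ratDegree φ) f g ∧ ReturnCondition (ratDegree φ) f g := by
  have ha := h.coeff_num_eq hφ
  have hb := h.coeff_denom_eq hφ
  have hint : (∀ i, i ≤ ratDegree φ - 1 → ‖a i‖ ≤ 1) ∧
      (∀ j, 1 ≤ j → j ≤ ratDegree φ - 1 → ‖b j‖ ≤ 1) :=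
    ⟨fun i hi => by rw [ha i (by omega)]; exact (f.coeff i).2,
      fun j _ hj => by rw [hb j (by omega)]; exact (g.coeff j).2⟩
  have hsumB : sumB (ratDegree φ) b = (g.eval 1 : ℤ_[2]) :=
    (sum_Icc_one_eq_sum_range _ hφ.denom_zero).trans (sumA_eq_eval_one hb h.natDegree_denom_le)
  have hcast : (2 : ℚ_[2]) = ((2 : ℤ_[2]) : ℚ_[2]) := rfl
  have hfour (x : ℤ_[2]) : CongMod 4 (x : ℚ_[2]) 1 ↔ 4 ∣ x - 1 := congMod_coe_iff 4 x 1
  have hnum (x : ℤ_[2]) : CongMod 4 (x : ℚ_[2]) (2 : ℤ_[2]) ↔ 4 ∣ x - 2 := congMod_coe_iff 4 x 2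
  have heven : 4 ∣ f.eval 1 - 2 → 2 ∣ f.eval 1 := fun ⟨t, ht⟩ =>
    ⟨1 + 2 * t, by linear_combination ht⟩
  rw [CoeffCondition, sumA_eq_eval_one ha h.natDegree_num_le, hsumB, sumA1, sumA2, sumA3,
    sum_filter_mod_eq_coeffSum ha, sum_filter_mod_eq_coeffSum ha, sum_filter_mod_eq_coeffSum ha,
    ha 0 (by omega), ha 1 (by omega), ha (_ - 1) (by omega), ha (_ - 2) (by omega),
    hb 1 (by omega), hb 2 (by omega), hb (_ - 1) (by omega), hb (_ - 2) (by omega), hcast]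
  simp only [← PadicInt.coe_sub, ← PadicInt.coe_mul, ← PadicInt.coe_add]
  rw [congMod_two_one_iff, congMod_two_one_iff, congMod_two_one_iff, congMod_two_one_iff,
    congMod_two_one_iff, hnum, hfour, h.isCyclicPair_iff hφ]
  exact ⟨fun ⟨_, h0, hg1, hf1, hsum, hcoeff, hsub, hmultiplier⟩ =>
    ⟨⟨h0, heven hf1, hg1⟩, hf1, hsum, hcoeff, hsub, hmultiplier⟩, fun ⟨⟨h0, _, hg1⟩, hret⟩ =>
    ⟨hint, h0, hg1, hret.four_dvd_num_eval_one, hret.isUnit_coeffSum, hret.isUnit_denom_coeff_one,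
      hret.isUnit_sub, hret.four_dvd_multiplier_sub⟩⟩

end IsIntegralModel

lemma exists_map_coe_ringHom_eq {p : ℕ} [Fact p.Prime] {P : ℚ_[p][X]}
    (hP : ∀ i, ‖P.coeff i‖ ≤ 1) : ∃ Q : ℤ_[p][X], P = Q.map PadicInt.Coe.ringHom := by
  have hlifts : P ∈ lifts (PadicInt.Coe.ringHom : ℤ_[p] →+* ℚ_[p]) :=
    (lifts_iff_coeff_lifts P).2 fun i => ⟨⟨P.coeff i, hP i⟩, rfl⟩
  obtain ⟨Q, hQ⟩ := (mem_lifts P).1 hlifts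
  exact ⟨Q, hQ.symm⟩

lemma CoeffCondition.exists_isIntegralModel (h : CoeffCondition (ratDegree φ) a b)
    (hφ : HasCoeffs φ a b) : ∃ f g, IsIntegralModel φ f g := by
  have norm_coeff_le {P : ℚ_[2][X]} (hP : P.natDegree ≤ ratDegree φ)
      (hlead : P.coeff (ratDegree φ) = 1) (hlt : ∀ i < ratDegree φ, ‖P.coeff i‖ ≤ 1) (i : ℕ) :
      ‖P.coeff i‖ ≤ 1 := by
    rcases lt_trichotomy i (ratDegree φ) with hi | rfl | hi
    · exact hlt i hi
    · rw [hlead, norm_one]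
    · rw [coeff_eq_zero_of_natDegree_lt (hP.trans_lt hi), norm_zero]
      exact zero_le_one
  obtain ⟨⟨ha, hb⟩, -⟩ := h
  have hnum (i : ℕ) (hi : i < ratDegree φ) : ‖φ.num.coeff i‖ ≤ 1 := by
    rw [hφ.num_coeff i hi.le]
    exact ha i (Nat.le_pred_of_lt hi)
  have hdenom (i : ℕ) (hi : i < ratDegree φ) : ‖φ.denom.coeff i‖ ≤ 1 := by
    rw [hφ.denom_coeff i hi.le]
    rcases i.eq_zero_or_pos with rfl | hi0
    · rw [hφ.denom_zero, norm_zero]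
      exact zero_le_one
    · exact hb i hi0 (Nat.le_pred_of_lt hi)
  obtain ⟨f, hf⟩ := exists_map_coe_ringHom_eq (norm_coeff_le (le_max_left ..)
    ((hφ.num_coeff _ le_rfl).trans hφ.num_lead) hnum)
  obtain ⟨g, hg⟩ := exists_map_coe_ringHom_eq (norm_coeff_le (le_max_right ..)
    ((hφ.denom_coeff _ le_rfl).trans hφ.denom_lead) hdenom)
  exact ⟨f, g, hf, hg⟩

lemma HasGoodReduction.exists_isCyclicPair (h : HasGoodReduction φ) (hφ : HasCoeffs φ a b)
    (hd : 0 < ratDegree φ) (hmin : IsMinimalSystem (ratMap φ)) :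
    ∃ f g, IsIntegralModel φ f g ∧ IsCyclicPair (ratDegree φ) f g := by
  obtain ⟨f, g, hmodel, hunit⟩ := h.exists_isIntegralModel hd
    ((hφ.num_coeff _ le_rfl).trans hφ.num_lead) ((hφ.denom_coeff _ le_rfl).trans hφ.denom_lead)
  have hf1 := two_dvd_eval_one_of_isMinimalSystem hmodel (hmodel.coeff_eq_one hφ).1 hmin
  have hzero := hunit 0
  rw [← coeff_zero_eq_eval_zero, ← coeff_zero_eq_eval_zero, hmodel.denom_coeff_zero hφ] at hzero
  exact ⟨f, g, hmodel, (hmodel.isCyclicPair_iff hφ).2 ⟨hzero.resolve_right not_isUnit_zero, hf1,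
    (hunit 1).resolve_left (two_dvd_iff_not_isUnit.1 hf1)⟩⟩

end Coefficients

end PadicDyn

end

theorem theorem1p4 (d : ℕ) (hd : 2 ≤ d) (a b : ℕ → ℚ_[2])
    (ha : a d = 1) (hb : b d = 1) (hb0 : b 0 = 0)
    (φ : RatFunc ℚ_[2]) (hφ : φ = PadicDyn.ratOfCoeffs d a b)
    (hdeg : PadicDyn.ratDegree φ = d) :
    (PadicDyn.HasGoodReduction φ ∧ PadicDyn.IsMinimalSystem (PadicDyn.ratMap φ) →
      PadicDyn.CoeffCondition d a b) ∧
    (PadicDyn.CoeffCondition d a b →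
      PadicDyn.IsOneLipschitz (PadicDyn.ratMap φ) ∧
        PadicDyn.IsMinimalSystem (PadicDyn.ratMap φ)) := by
  have hcoeffs := PadicDyn.hasCoeffs_ratOfCoeffs hφ (zero_lt_two.trans_le hd) hdeg ha hb hb0
  subst hdeg
  constructor
  · rintro ⟨hgood, hmin⟩
    obtain ⟨f, g, hmodel, hcyclic⟩ :=
      hgood.exists_isCyclicPair hcoeffs (zero_lt_two.trans_le hd) hmin
    exact (hmodel.coeffCondition_iff hcoeffs hd).2
      ⟨hcyclic, (hcyclic.isMinimalSystem_iff hmodel hd).1 hmin⟩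
  · intro hcond
    obtain ⟨f, g, hmodel⟩ := hcond.exists_isIntegralModel hcoeffs
    obtain ⟨hcyclic, hreturn⟩ := (hmodel.coeffCondition_iff hcoeffs hd).1 hcond
    exact ⟨hcyclic.isOneLipschitz hmodel hd hreturn,
      (hcyclic.isMinimalSystem_iff hmodel hd).2 hreturn⟩
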